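/- Let $p\ge 1$ be a fixed integer. For $w_0,w_1,\dots,w_n\in\mathbb{Z}_{\ge 0}$ consider the minimum-knapsack set $\Pi=\{x\in\{0,1\}^n : \sum_{j=1}^n w_jx_j\ge w_0\}$. Say that an inequality $\sum_{j=1}^n\alpha_jx_j\ge\alpha_0$ has coefficients in $\{0,1,\dots,p\}$ if $\alpha_j\in\{0,1,\dots,p\}$ for all $0\le j\le n$, and that it is valid if every $x\in\Pi$ satisfies it. There is an algorithm that, given $n$, the numbers $w_0,\dots,w_n$, a number $0<\epsilon<1$ and a vector $x^*\in[0,1]^n$, either finds a valid inequality with coefficients in $\{0,1,\dots,p\}$ that is violated by $x^*$, i.e. $\sum_{j}\alpha_jx^*_j<\alpha_0$, or correctly reports that $x^*$ satisfies all valid inequalities with coefficients in $\{0,1,\dots,p\}$ within additive error $\epsilon$, i.e. $\sum_{j}\alpha_jx^*_j\ge\alpha_0-\epsilon$. The running time of the algorithm, counted as the number of elementary operations (additions, subtractions, comparisons and memory accesses) of a random access machine on the given numbers, is bounded by a polynomial in $n$ and $1/\epsilon$ that depends only on $p$. -/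

import Mathlib

/-! ### Minimum-knapsack sets and their valid inequalities -/

/-- The minimum-knapsack set `{x ∈ {0,1}^n : ∑ j, w j * x j ≥ w₀}`, as a subset of `ℝ^n`. -/
def minKnapsack {n : ℕ} (w : Fin n → ℕ) (w₀ : ℕ) : Set (Fin n → ℝ) :=
  {x | (∀ j, x j = 0 ∨ x j = 1) ∧ (w₀ : ℝ) ≤ ∑ j, (w j : ℝ) * x j}

/-- The inequality `∑ j, α j * x j ≥ α₀` is valid for `X`. -/
def IsValidIneq {n : ℕ} (X : Set (Fin n → ℝ)) (α : Fin n → ℕ) (α₀ : ℕ) : Prop :=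
  ∀ x ∈ X, (α₀ : ℝ) ≤ ∑ j, (α j : ℝ) * x j

/-- All coefficients of the inequality `∑ j, α j * x j ≥ α₀`, the right-hand side included,
lie in `{0, 1, …, p}`. -/
def CoeffsUpTo {n : ℕ} (p : ℕ) (α : Fin n → ℕ) (α₀ : ℕ) : Prop :=
  (∀ j, α j ≤ p) ∧ α₀ ≤ p

/-! ### Random access machines

Programs for a random access machine with two kinds of memory: arrays of natural numbers, which
are also used for addressing, and arrays of real numbers. The arithmetic operations are addition,
subtraction and comparison only; every operation and every memory access costs one unit of time.
There is no multiplication, division or rounding: one operation at most doubles the size of the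
largest number (or of the largest constant of the program), so the bit lengths grow at most
linearly with the running time and unit cost is a fair measure. -/

namespace RAM

/-- A memory state: cell `i` of the integer array `a` holds `nat a i`, cell `i` of the real array
`a` holds `num a i`. -/
structure Store where
  nat : ℕ → ℕ → ℕ
  num : ℕ → ℕ → ℝ

/-- Integer expressions. -/
inductive IExp where
  | lit (k : ℕ)
  | get (a : ℕ) (i : IExp)
  | add (e f : IExp)
  | sub (e f : IExp)

/-- Real expressions. -/
inductive RExp where
  | lit (k : ℕ)
  | get (a : ℕ) (i : IExp)
  | add (e f : RExp)
  | sub (e f : RExp)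

/-- Tests. -/
inductive Test where
  | ile (e f : IExp)
  | rle (e f : RExp)
  | not (b : Test)
  | and (b c : Test)

/-- The value of an integer expression (`sub` is truncated at `0`). -/
def IExp.val (s : Store) : IExp → ℕ
  | .lit k => k
  | .get a i => s.nat a (i.val s)
  | .add e f => e.val s + f.val s
  | .sub e f => e.val s - f.val s

/-- The time needed to evaluate an integer expression: the number of its nodes. -/
def IExp.cost : IExp → ℕ
  | .lit _ => 1
  | .get _ i => i.cost + 1
  | .add e f => e.cost + f.cost + 1
  | .sub e f => e.cost + f.cost + 1

/-- The value of a real expression. -/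
noncomputable def RExp.val (s : Store) : RExp → ℝ
  | .lit k => k
  | .get a i => s.num a (i.val s)
  | .add e f => e.val s + f.val s
  | .sub e f => e.val s - f.val s

/-- The time needed to evaluate a real expression: the number of its nodes. -/
def RExp.cost : RExp → ℕ
  | .lit _ => 1
  | .get _ i => i.cost + 1
  | .add e f => e.cost + f.cost + 1
  | .sub e f => e.cost + f.cost + 1

/-- The test succeeds in the memory state `s`. -/
def Test.holds (s : Store) : Test → Prop
  | .ile e f => e.val s ≤ f.val s
  | .rle e f => e.val s ≤ f.val s
  | .not b => ¬ b.holds s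
  | .and b c => b.holds s ∧ c.holds s

/-- The time needed to evaluate a test: the number of its nodes. -/
def Test.cost : Test → ℕ
  | .ile e f => e.cost + f.cost + 1
  | .rle e f => e.cost + f.cost + 1
  | .not b => b.cost + 1
  | .and b c => b.cost + c.cost + 1

/-- Programs. -/
inductive Program where
  | skip
  | iset (a : ℕ) (i e : IExp)
  | rset (a : ℕ) (i : IExp) (e : RExp)
  | seq (P Q : Program)
  | ite (b : Test) (P Q : Program)
  | loop (b : Test) (P : Program)

/-- Write `v` into cell `i` of the integer array `a`. -/
def Store.setNat (s : Store) (a i v : ℕ) : Store :=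
  { s with nat := fun a' i' => if a' = a ∧ i' = i then v else s.nat a' i' }

/-- Write `v` into cell `i` of the real array `a`. -/
noncomputable def Store.setNum (s : Store) (a i : ℕ) (v : ℝ) : Store :=
  { s with num := fun a' i' => if a' = a ∧ i' = i then v else s.num a' i' }

/-- `Exec P s s' t`: the program `P`, started in the memory state `s`, halts after exactly `t`
units of time in the memory state `s'`. (`loop b P` repeats `P` while the test `b` succeeds; a
program that does not halt on `s` is in relation to no `s'` and `t`.) -/
inductive Exec : Program → Store → Store → ℕ → Prop where
  | skip (s : Store) : Exec .skip s s 1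
  | iset (a : ℕ) (i e : IExp) (s : Store) :
      Exec (.iset a i e) s (s.setNat a (i.val s) (e.val s)) (i.cost + e.cost + 1)
  | rset (a : ℕ) (i : IExp) (e : RExp) (s : Store) :
      Exec (.rset a i e) s (s.setNum a (i.val s) (e.val s)) (i.cost + e.cost + 1)
  | seq {P Q : Program} {s s' s'' : Store} {t t' : ℕ} :
      Exec P s s' t → Exec Q s' s'' t' → Exec (.seq P Q) s s'' (t + t')
  | ite_true {b : Test} {P : Program} (Q : Program) {s s' : Store} {t : ℕ} :
      b.holds s → Exec P s s' t → Exec (.ite b P Q) s s' (b.cost + t + 1)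
  | ite_false {b : Test} (P : Program) {Q : Program} {s s' : Store} {t : ℕ} :
      ¬ b.holds s → Exec Q s s' t → Exec (.ite b P Q) s s' (b.cost + t + 1)
  | loop_done {b : Test} (P : Program) {s : Store} :
      ¬ b.holds s → Exec (.loop b P) s s (b.cost + 1)
  | loop_step {b : Test} {P : Program} {s s' s'' : Store} {t t' : ℕ} :
      b.holds s → Exec P s s' t → Exec (.loop b P) s' s'' t' →
        Exec (.loop b P) s s'' (b.cost + t + t' + 1)

/-- Programs are deterministic: the final memory state and the running time are determined by the
initial memory state. -/
theorem Exec.deterministic {P : Program} {s s₁ s₂ : Store} {t₁ t₂ : ℕ}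
    (h₁ : Exec P s s₁ t₁) (h₂ : Exec P s s₂ t₂) : s₁ = s₂ ∧ t₁ = t₂ := by
  induction h₁ generalizing s₂ t₂ with
  | skip s => cases h₂; exact ⟨rfl, rfl⟩
  | iset a i e s => cases h₂; exact ⟨rfl, rfl⟩
  | rset a i e s => cases h₂; exact ⟨rfl, rfl⟩
  | seq _ _ ih ih' =>
    cases h₂ with
    | seq k k' =>
      obtain ⟨rfl, rfl⟩ := ih k
      obtain ⟨rfl, rfl⟩ := ih' k'
      exact ⟨rfl, rfl⟩
  | ite_true Q hb _ ih =>
    cases h₂ with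
    | ite_true _ _ k => obtain ⟨rfl, rfl⟩ := ih k; exact ⟨rfl, rfl⟩
    | ite_false _ hb' _ => exact absurd hb hb'
  | ite_false P hb _ ih =>
    cases h₂ with
    | ite_true _ hb' _ => exact absurd hb' hb
    | ite_false _ _ k => obtain ⟨rfl, rfl⟩ := ih k; exact ⟨rfl, rfl⟩
  | loop_done P hb =>
    cases h₂ with
    | loop_done _ _ => exact ⟨rfl, rfl⟩
    | loop_step hb' _ _ => exact absurd hb' hb
  | loop_step hb _ _ ih ih' =>
    cases h₂ with
    | loop_done _ hb' => exact absurd hb hb'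
    | loop_step _ k k' =>
      obtain ⟨rfl, rfl⟩ := ih k
      obtain ⟨rfl, rfl⟩ := ih' k'
      exact ⟨rfl, rfl⟩

end RAM

/-! ### Input and output of the separation problem -/

/-- Cells `0, …, n - 1` of an array hold `v`, the remaining cells hold `0`. -/
noncomputable def arrayOf {n : ℕ} (v : Fin n → ℝ) : ℕ → ℝ :=
  fun i => if h : i < n then v ⟨i, h⟩ else 0

/-- The initial memory state. Cell `0` of the integer array `0` holds `n`; the real arrays `0` and
`1` hold `w` and `x`; cell `0` of the real arrays `2` and `3` holds `w₀` and `ε`. All other cells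
hold `0`. -/
noncomputable def sepInput {n : ℕ} (w : Fin n → ℕ) (w₀ : ℕ) (ε : ℝ) (x : Fin n → ℝ) :
    RAM.Store where
  nat := fun a i => if a = 0 ∧ i = 0 then n else 0
  num := fun a i =>
    match a with
    | 0 => arrayOf (fun j => (w j : ℝ)) i
    | 1 => arrayOf x i
    | 2 => if i = 0 then (w₀ : ℝ) else 0
    | 3 => if i = 0 then ε else 0
    | _ => 0

/-- The answer flag: cell `0` of the integer array `1`. -/
def outFlag (s : RAM.Store) : ℕ := s.nat 1 0

/-- The left-hand coefficients of the inequality in the output: cells `0, …, n - 1` of the integer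
array `2`. -/
def outCoeff (n : ℕ) (s : RAM.Store) : Fin n → ℕ := fun j => s.nat 2 j

/-- The right-hand side of the inequality in the output: cell `0` of the integer array `3`. -/
def outRhs (s : RAM.Store) : ℕ := s.nat 3 0

/-- The answer in the final memory state `s` is correct. Flag `1`: the inequality in the output has
coefficients in `{0, …, p}`, is valid and is violated by `x`. Flag `0`: every valid inequality with
coefficients in `{0, …, p}` is satisfied by `x` within additive error `ε`. -/
def CorrectAnswer {n : ℕ} (p : ℕ) (w : Fin n → ℕ) (w₀ : ℕ) (ε : ℝ) (x : Fin n → ℝ)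
    (s : RAM.Store) : Prop :=
  (outFlag s = 1 ∧
    CoeffsUpTo p (outCoeff n s) (outRhs s) ∧
    IsValidIneq (minKnapsack w w₀) (outCoeff n s) (outRhs s) ∧
    ∑ j, (outCoeff n s j : ℝ) * x j < (outRhs s : ℝ)) ∨
  (outFlag s = 0 ∧
    ∀ (α : Fin n → ℕ) (α₀ : ℕ), CoeffsUpTo p α α₀ → IsValidIneq (minKnapsack w w₀) α α₀ →
      (α₀ : ℝ) - ε ≤ ∑ j, (α j : ℝ) * x j)

/-!
# Approximate separation of inequalities with bounded coefficients

An inequality `∑ α j * x j ≥ b` with `b ≥ 1` is valid for the minimum-knapsack set exactly if every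
set of items of total coefficient at most `b - 1` has weight less than `w₀`. The heaviest such set
contains all items with coefficient `0` and less than `p` others, which can be chosen among the `p`
heaviest items of each coefficient class. So these `p` items are guessed for each class `1, …, p`
(`exists_class_guess`). Once they are fixed, any other item may enter a class if it is not heavier
than the lightest item guessed there: by an exchange argument (`exists_exchange`), this does not
increase the maximal contribution of the nonzero coefficients. Hence every item has a cheapest
admissible nonzero coefficient, its `label`, and what remains is to choose the set of items that get
their labels, as heavy as possible while `∑ label j * x j` stays small; all other items get
coefficient `0` (`exists_guess`). This is a knapsack problem. With `x j` replaced by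
`n * p * x j / ε` rounded down, the number of cost levels is polynomial, the recursion `knapsack`
solves the problem exactly, and the rounding costs at most `ε` (`rounded_cost_le`).

The algorithm runs through all guesses of items, cost level and right-hand side. For each it forms
the optimal candidate, and it checks validity (by the same knapsack recursion, now with the
coefficients as costs) and violation. Hence a raised flag is always correct, and
`exists_passing_guess` shows that the flag is raised if some valid inequality is violated by more
than `ε`.

The program is written in a small language `RAM.Cmd` of counting loops. Such commands have a total
denotational semantics `RAM.Cmd.run`, an invariant rule `RAM.Cmd.run_rep`, and a running time that
is polynomial in the loop bounds (`RAM.Cmd.exec_compile`). The one loop outside this language adds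
up `ε` until the sum reaches `1`, and thereby counts up to `K`, which is `1 / ε` rounded up.

The integer arrays are used as follows: `5` holds the product that determines the number of cost
levels, `6` the rounded values `q` of `n * p * x j / ε`, `7` the labels, `8` the labels times `q`,
`9`, `10` and `11` loop counters, `12` the start of the current row of the dynamic programming
table, `13` the current cost level, and `20 + d` the guesses. The cells `0, …, 4` of array `4` hold
the loop bounds `n`, `K`, the number of cost levels, `n + 1` and `p + 1`. Of the real arrays, `4` is
scratch space, `5` holds the dynamic programming table, `6` the slack of the candidate, and `7` the
values of the items in the knapsack problem.
-/

/-! ### A for-loop language -/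

namespace RAM

/-- Commands whose only loops are counting loops. `rep v k c` runs `c` with cell `0` of the integer
array `v` set to `0, 1, …, m - 1`, where `m` is held by cell `k` of the integer array `4`; that
array is reserved for loop bounds. -/
inductive Cmd where
  | skip
  | iset (a : ℕ) (i e : IExp)
  | rset (a : ℕ) (i : IExp) (e : RExp)
  | seq (c d : Cmd)
  | ite (b : Test) (c d : Cmd)
  | rep (v k : ℕ) (c : Cmd)

namespace Cmd

/-- The test `v[0] < 4[k]` that controls a counting loop. -/
def repTest (v k : ℕ) : Test := .ile (.add (.get v (.lit 0)) (.lit 1)) (.get 4 (.lit k))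

/-- The translation into programs. -/
def compile : Cmd → Program
  | skip => .skip
  | iset a i e => .iset a i e
  | rset a i e => .rset a i e
  | seq c d => .seq c.compile d.compile
  | ite b c d => .ite b c.compile d.compile
  | rep v k c => .seq (.iset v (.lit 0) (.lit 0)) (.loop (repTest v k)
      (.seq c.compile (.iset v (.lit 0) (.add (.get v (.lit 0)) (.lit 1)))))

/-- The memory state after `i` rounds of a counting loop with counter `v`, where `f` is the effect
of the body. -/
def rounds (f : Store → Store) (v : ℕ) (s : Store) : ℕ → Store
  | 0 => s.setNat v 0 0
  | i + 1 => (f (rounds f v s i)).setNat v 0 (i + 1)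

open Classical in
/-- The effect of a command on the memory. -/
noncomputable def run : Cmd → Store → Store
  | skip, s => s
  | iset a i e, s => s.setNat a (i.val s) (e.val s)
  | rset a i e, s => s.setNum a (i.val s) (e.val s)
  | seq c d, s => d.run (c.run s)
  | ite b c d, s => if b.holds s then c.run s else d.run s
  | rep v k c, s => rounds c.run v s (s.nat 4 k)

/-- The command writes into no cell of the integer array `a`. -/
def Keeps (a : ℕ) : Cmd → Prop
  | skip => True
  | iset b _ _ => a ≠ b
  | rset _ _ _ => True
  | seq c d => c.Keeps a ∧ d.Keeps a
  | ite _ c d => c.Keeps a ∧ d.Keeps a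
  | rep v _ c => a ≠ v ∧ c.Keeps a

/-- The command writes into no cell of the real array `a`. -/
def KeepsNum (a : ℕ) : Cmd → Prop
  | skip => True
  | iset _ _ _ => True
  | rset b _ _ => a ≠ b
  | seq c d => c.KeepsNum a ∧ d.KeepsNum a
  | ite _ c d => c.KeepsNum a ∧ d.KeepsNum a
  | rep _ _ c => c.KeepsNum a

/-- No counting loop tampers with its own counter. -/
def WF : Cmd → Prop
  | skip => True
  | iset _ _ _ => True
  | rset _ _ _ => True
  | seq c d => c.WF ∧ d.WF
  | ite _ c d => c.WF ∧ d.WF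
  | rep v _ c => c.Keeps v ∧ c.WF

/-- A bound for the running time, as a polynomial in a common bound for all loop bounds. -/
noncomputable def time : Cmd → Polynomial ℕ
  | skip => 1
  | iset _ i e => (i.cost + e.cost + 1 : ℕ)
  | rset _ i e => (i.cost + e.cost + 1 : ℕ)
  | seq c d => c.time + d.time
  | ite b c d => (b.cost + 1 : ℕ) + c.time + d.time
  | rep _ _ c => 11 + Polynomial.X * (c.time + 14)

end Cmd

@[simp] theorem Store.setNat_nat (s : Store) (a i v b j : ℕ) :
    (s.setNat a i v).nat b j = if b = a ∧ j = i then v else s.nat b j := rfl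

@[simp] theorem Store.setNat_num (s : Store) (a i v : ℕ) : (s.setNat a i v).num = s.num := rfl

@[simp] theorem Store.setNum_num (s : Store) (a i : ℕ) (v : ℝ) (b j : ℕ) :
    (s.setNum a i v).num b j = if b = a ∧ j = i then v else s.num b j := rfl

@[simp] theorem Store.setNum_nat (s : Store) (a i : ℕ) (v : ℝ) : (s.setNum a i v).nat = s.nat := rfl

theorem Store.setNat_nat_of_ne (s : Store) {a b : ℕ} (i v : ℕ) (h : b ≠ a) :
    (s.setNat a i v).nat b = s.nat b := by
  funext j; simp [h]

theorem Store.setNum_num_of_ne (s : Store) {a b : ℕ} (i : ℕ) (v : ℝ) (h : b ≠ a) :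
    (s.setNum a i v).num b = s.num b := by
  funext j; simp [h]

namespace Cmd

theorem run_nat {a : ℕ} {c : Cmd} (h : c.Keeps a) (s : Store) : (c.run s).nat a = s.nat a := by
  induction c generalizing s with
  | skip => rfl
  | iset b i e => exact Store.setNat_nat_of_ne _ _ _ h
  | rset b i e => rfl
  | seq c d hc hd => exact (hd h.2 _).trans (hc h.1 _)
  | ite b c d hc hd =>
    simp only [run]
    split
    · exact hc h.1 _
    · exact hd h.2 _
  | rep v k c hc =>
    simp only [run]
    generalize s.nat 4 k = m
    induction m with
    | zero => exact Store.setNat_nat_of_ne _ _ _ h.1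
    | succ m ih => exact (Store.setNat_nat_of_ne _ _ _ h.1).trans ((hc h.2 _).trans ih)

theorem run_num {a : ℕ} {c : Cmd} (h : c.KeepsNum a) (s : Store) :
    (c.run s).num a = s.num a := by
  induction c generalizing s with
  | skip => rfl
  | iset b i e => rfl
  | rset b i e => exact Store.setNum_num_of_ne _ _ _ h
  | seq c d hc hd => exact (hd h.2 _).trans (hc h.1 _)
  | ite b c d hc hd =>
    simp only [run]
    split
    · exact hc h.1 _
    · exact hd h.2 _
  | rep v k c hc =>
    simp only [run]
    generalize s.nat 4 k = m
    induction m with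
    | zero => rfl
    | succ m ih => exact (hc h _).trans ih

theorem rounds_counter (f : Store → Store) (v : ℕ) (s : Store) (i : ℕ) :
    (rounds f v s i).nat v 0 = i := by
  cases i <;> simp [rounds]

theorem rounds_nat {a v : ℕ} {c : Cmd} (hv : a ≠ v) (h : c.Keeps a) (s : Store) (i : ℕ) :
    (rounds c.run v s i).nat a = s.nat a := by
  induction i with
  | zero => exact Store.setNat_nat_of_ne _ _ _ hv
  | succ m ih => exact (Store.setNat_nat_of_ne _ _ _ hv).trans ((run_nat h _).trans ih)

theorem rounds_num {a v : ℕ} {c : Cmd} (h : c.KeepsNum a) (s : Store) (i : ℕ) :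
    (rounds c.run v s i).num a = s.num a := by
  induction i with
  | zero => rfl
  | succ m ih => exact (run_num h _).trans ih

/-- The invariant rule for counting loops. Inside the loop, the counter and all arrays that the body
does not write are known. -/
theorem run_rep {v k : ℕ} {c : Cmd} {s : Store} (I : ℕ → Store → Prop)
    (h0 : I 0 (s.setNat v 0 0))
    (hs : ∀ i < s.nat 4 k, ∀ s', I i s' → s'.nat v 0 = i →
      (∀ a, a ≠ v → c.Keeps a → s'.nat a = s.nat a) →
      (∀ a, c.KeepsNum a → s'.num a = s.num a) →
      I (i + 1) ((c.run s').setNat v 0 (i + 1))) :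
    I (s.nat 4 k) ((rep v k c).run s) := by
  have key : ∀ i ≤ s.nat 4 k, I i (rounds c.run v s i) := by
    intro i
    induction i with
    | zero => exact fun _ => h0
    | succ i ih =>
      intro hi
      exact hs i hi _ (ih (by omega)) (rounds_counter _ _ _ _)
        (fun a ha hc => rounds_nat ha hc s i) (fun a hc => rounds_num hc s i)
  exact key _ le_rfl

/-- A well-formed command that leaves the loop bounds alone compiles to a program with the same
effect, and it halts within its time bound. -/
theorem exec_compile {c : Cmd} (hwf : c.WF) (h4 : c.Keeps 4) {s : Store} {M : ℕ}
    (hM : ∀ i, s.nat 4 i ≤ M) :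
    ∃ t ≤ c.time.eval M, Exec c.compile s (c.run s) t := by
  induction c generalizing s with
  | skip => exact ⟨1, by simp [time], .skip s⟩
  | iset a i e => exact ⟨_, by simp [time], .iset a i e s⟩
  | rset a i e => exact ⟨_, by simp [time], .rset a i e s⟩
  | seq c d hc hd =>
    obtain ⟨t, ht, h⟩ := hc hwf.1 h4.1 hM
    have hM' : ∀ i, (c.run s).nat 4 i ≤ M := by rwa [run_nat h4.1]
    obtain ⟨t', ht', h'⟩ := hd hwf.2 h4.2 hM'
    exact ⟨t + t', by simpa [time] using add_le_add ht ht', .seq h h'⟩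
  | ite b c d hc hd =>
    by_cases hb : b.holds s
    · obtain ⟨t, ht, h⟩ := hc hwf.1 h4.1 hM
      refine ⟨_, ?_, by simpa only [run, if_pos hb] using! Exec.ite_true d.compile hb h⟩
      simp only [time, Polynomial.eval_add, Polynomial.eval_natCast]
      simp only [Nat.cast_id]
      omega
    · obtain ⟨t, ht, h⟩ := hd hwf.2 h4.2 hM
      refine ⟨_, ?_, by simpa only [run, if_neg hb] using! Exec.ite_false c.compile hb h⟩
      simp only [time, Polynomial.eval_add, Polynomial.eval_natCast]
      simp only [Nat.cast_id]
      omega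
  | rep v k c hc =>
    have hb : ∀ i, (repTest v k).holds (rounds c.run v s i) ↔ i + 1 ≤ s.nat 4 k := by
      intro i
      simp only [repTest, Test.holds, IExp.val, rounds_counter, rounds_nat h4.1 h4.2]
    have key : ∀ r i, i + r = s.nat 4 k → ∃ t ≤ r * (c.time.eval M + 14) + 8,
        Exec (.loop (repTest v k)
          (.seq c.compile (.iset v (.lit 0) (.add (.get v (.lit 0)) (.lit 1)))))
          (rounds c.run v s i) (rounds c.run v s (s.nat 4 k)) t := by
      intro r
      induction r with
      | zero =>
        intro i hi
        obtain rfl : i = s.nat 4 k := by omega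
        exact ⟨_, by simp [repTest, Test.cost, IExp.cost],
          .loop_done _ (by rw [hb]; omega)⟩
      | succ r ih =>
        intro i hi
        obtain ⟨t, ht, h⟩ := ih (i + 1) (by omega)
        obtain ⟨t', ht', h'⟩ := hc hwf.2 h4.2 (s := rounds c.run v s i)
          (by rwa [rounds_nat h4.1 h4.2])
        have hset := Exec.iset v (.lit 0) (.add (.get v (.lit 0)) (.lit 1))
          (c.run (rounds c.run v s i))
        have hst : ((c.run (rounds c.run v s i)).setNat v
            (IExp.val (c.run (rounds c.run v s i)) (.lit 0))
            (IExp.val (c.run (rounds c.run v s i)) (.add (.get v (.lit 0)) (.lit 1))))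
            = rounds c.run v s (i + 1) := by
          simp only [IExp.val, rounds, run_nat hwf.1, rounds_counter]
        rw [hst] at hset
        refine ⟨_, ?_, .loop_step (by rw [hb]; omega) (.seq h' hset) h⟩
        simp only [repTest, Test.cost, IExp.cost]
        rw [add_mul]
        omega
    obtain ⟨t, ht, h⟩ := key (s.nat 4 k) 0 (by omega)
    refine ⟨_, ?_, .seq (.iset v (.lit 0) (.lit 0) s) h⟩
    have := Nat.mul_le_mul_right (c.time.eval M + 14) (hM k)
    simp only [time, IExp.cost, Polynomial.eval_add, Polynomial.eval_mul, Polynomial.eval_X,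
      Polynomial.eval_ofNat]
    omega

end Cmd

/-- The expression `k * e`, written as a sum. -/
def IExp.nsmul (k : ℕ) (e : IExp) : IExp :=
  match k with
  | 0 => .lit 0
  | k + 1 => .add (nsmul k e) e

/-- The expression `k * e`, written as a sum. -/
def RExp.nsmul (k : ℕ) (e : RExp) : RExp :=
  match k with
  | 0 => .lit 0
  | k + 1 => .add (nsmul k e) e

@[simp] theorem IExp.nsmul_val (k : ℕ) (e : IExp) (s : Store) :
    (IExp.nsmul k e).val s = k * e.val s := by
  induction k with
  | zero => simp [IExp.nsmul, IExp.val]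
  | succ k ih => simp [IExp.nsmul, IExp.val, ih, add_mul]

@[simp] theorem RExp.nsmul_val (k : ℕ) (e : RExp) (s : Store) :
    (RExp.nsmul k e).val s = k * e.val s := by
  induction k with
  | zero => simp [RExp.nsmul, RExp.val]
  | succ k ih => simp [RExp.nsmul, RExp.val, ih, add_mul]

end RAM

/-! ### The knapsack recursion -/

/-- The recursion of the knapsack dynamic programme: the largest total value `v` of a set of items
`i < j` whose total cost `c` is at most `l`. -/
noncomputable def knapsack (c : ℕ → ℕ) (v : ℕ → ℝ) : ℕ → ℕ → ℝ
  | 0, _ => 0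
  | j + 1, l =>
    if c j ≤ l ∧ knapsack c v j l < knapsack c v j (l - c j) + v j then
      knapsack c v j (l - c j) + v j
    else knapsack c v j l

theorem knapsack_congr {c c' : ℕ → ℕ} {v v' : ℕ → ℝ} {n : ℕ} (hc : ∀ j < n, c j = c' j)
    (hv : ∀ j < n, v j = v' j) (l : ℕ) : knapsack c v n l = knapsack c' v' n l := by
  induction n generalizing l with
  | zero => rfl
  | succ n ih =>
    have ih' := fun l => ih (fun j hj => hc j (by omega)) (fun j hj => hv j (by omega)) l
    simp only [knapsack, ih', hc n (by omega), hv n (by omega)]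

theorem le_knapsack {c : ℕ → ℕ} {v : ℕ → ℝ} {n l : ℕ} {S : Finset ℕ} (hS : S ⊆ Finset.range n)
    (hl : ∑ j ∈ S, c j ≤ l) : ∑ j ∈ S, v j ≤ knapsack c v n l := by
  induction n generalizing l S with
  | zero =>
    obtain rfl : S = ∅ := by simpa using hS
    simp [knapsack]
  | succ n ih =>
    have hmono : knapsack c v n l ≤ knapsack c v (n + 1) l := by
      simp only [knapsack]
      split
      next h => exact h.2.le
      next => exact le_rfl
    by_cases hn : n ∈ S
    · have h1 := Finset.add_sum_erase S c hn
      have h2 := Finset.add_sum_erase S v hn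
      have hsub : S.erase n ⊆ Finset.range n := by
        intro j hj
        have := Finset.mem_range.1 (hS (Finset.mem_of_mem_erase hj))
        have := Finset.ne_of_mem_erase hj
        exact Finset.mem_range.2 (by omega)
      have h3 := ih hsub (l := l - c n) (by omega)
      have h4 : knapsack c v n (l - c n) + v n ≤ knapsack c v (n + 1) l := by
        simp only [knapsack]
        split
        next h => exact le_rfl
        next h =>
          have h5 : c n ≤ l := by omega
          exact not_lt.1 fun h6 => h ⟨h5, h6⟩
      linarith
    · refine (ih (fun j hj => ?_) hl).trans hmono
      have := Finset.mem_range.1 (hS hj)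
      have : j ≠ n := by rintro rfl; exact hn hj
      exact Finset.mem_range.2 (by omega)

theorem exists_knapsack_eq (c : ℕ → ℕ) (v : ℕ → ℝ) (n l : ℕ) :
    ∃ S ⊆ Finset.range n, ∑ j ∈ S, c j ≤ l ∧ ∑ j ∈ S, v j = knapsack c v n l := by
  induction n generalizing l with
  | zero => exact ⟨∅, by simp [knapsack]⟩
  | succ n ih =>
    have hsub : Finset.range n ⊆ Finset.range (n + 1) := Finset.range_subset_range.2 (by omega)
    simp only [knapsack]
    split
    next h =>
      obtain ⟨S, hS, h1, h2⟩ := ih (l - c n)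
      have hn : n ∉ S := fun h => by simpa using hS h
      refine ⟨insert n S, ?_, ?_, ?_⟩
      · exact Finset.insert_subset (by simp) (hS.trans hsub)
      · rw [Finset.sum_insert hn]; omega
      · rw [Finset.sum_insert hn, h2, add_comm]
    next h =>
      obtain ⟨S, hS, h1, h2⟩ := ih l
      exact ⟨S, hS.trans hsub, h1, h2⟩

/-! ### Guessing the heaviest items of each coefficient class -/

section Labels

variable (p : ℕ) (w : ℕ → ℝ) (g : ℕ → ℕ) (j : ℕ)

/-- The least class `≤ m` that item `j` may join without exceeding the weight of the item
`g ((k - 1) * p)`, the lightest one guessed for class `k`; it is `0` if there is none. -/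
noncomputable def classLabel : ℕ → ℕ
  | 0 => 0
  | k + 1 => if classLabel k = 0 ∧ w j ≤ w (g (k * p)) then k + 1 else classLabel k

/-- The label of item `j` when the guesses `g 0, …, g (m - 1)` are taken into account: the guess
`g d` puts an item into class `d / p + 1`. -/
noncomputable def guessLabel : ℕ → ℕ
  | 0 => classLabel p w g j p
  | d + 1 => if g d = j then d / p + 1 else guessLabel d

/-- The coefficient that item `j` gets if it gets a nonzero coefficient at all. The guess `g`
lists `p` items for each of the `p` nonzero coefficients. -/
noncomputable def label : ℕ := guessLabel p w g j (p * p)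

theorem classLabel_le (m : ℕ) : classLabel p w g j m ≤ m := by
  induction m with
  | zero => simp [classLabel]
  | succ m ih => simp only [classLabel]; split <;> omega

theorem guessLabel_le {m : ℕ} (hm : m ≤ p * p) : guessLabel p w g j m ≤ p := by
  induction m with
  | zero => exact classLabel_le p w g j p
  | succ m ih =>
    simp only [guessLabel]
    split
    · have : m / p < p := Nat.div_lt_of_lt_mul (by omega)
      omega
    · exact ih (by omega)

theorem label_le : label p w g j ≤ p := guessLabel_le p w g j le_rfl

variable {p w g j}

theorem weight_le_of_classLabel {m k : ℕ} (h : classLabel p w g j m = k + 1) :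
    w j ≤ w (g (k * p)) := by
  induction m with
  | zero => simp [classLabel] at h
  | succ m ih =>
    simp only [classLabel] at h
    split at h
    next h' => obtain rfl : m = k := by omega
               exact h'.2
    next => exact ih h

theorem classLabel_pos {m k : ℕ} (hk : k < m) (h : w j ≤ w (g (k * p))) :
    0 < classLabel p w g j m ∧ classLabel p w g j m ≤ k + 1 := by
  induction m with
  | zero => omega
  | succ m ih =>
    have hle := classLabel_le p w g j m
    simp only [classLabel]
    rcases Nat.lt_succ_iff_lt_or_eq.1 hk with hk | rfl
    · have := ih hk
      rw [if_neg (by omega)]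
      exact this
    · split
      next => omega
      next h' => exact ⟨Nat.pos_of_ne_zero fun h0 => h' ⟨h0, h⟩, by omega⟩

theorem guessLabel_of_forall_ne {m : ℕ} (h : ∀ d < m, g d ≠ j) :
    guessLabel p w g j m = classLabel p w g j p := by
  induction m with
  | zero => rfl
  | succ m ih =>
    simp only [guessLabel]
    rw [if_neg (h m (by omega)), ih fun d hd => h d (by omega)]

theorem guessLabel_eq {m k : ℕ} (h : ∃ d < m, g d = j) (h' : ∀ d < m, g d = j → d / p = k) :
    guessLabel p w g j m = k + 1 := by
  induction m with
  | zero => simp at h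
  | succ m ih =>
    simp only [guessLabel]
    split
    next hm => rw [h' m (by omega) hm]
    next hm =>
      obtain ⟨d, hd, hdj⟩ := h
      have : d ≠ m := by rintro rfl; exact hm hdj
      exact ih ⟨d, by omega, hdj⟩ fun d hd => h' d (by omega)

theorem label_congr {g' : ℕ → ℕ} (h : ∀ d < p * p, g d = g' d) :
    label p w g j = label p w g' j := by
  have h1 : ∀ m ≤ p, classLabel p w g j m = classLabel p w g' j m := by
    intro m hm
    induction m with
    | zero => rfl
    | succ m ih =>
      have : m * p < p * p := by nlinarith
      simp only [classLabel, ih (by omega), h _ this]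
  have h2 : ∀ m ≤ p * p, guessLabel p w g j m = guessLabel p w g' j m := by
    intro m hm
    induction m with
    | zero => exact h1 p le_rfl
    | succ m ih => simp only [guessLabel, ih (by omega), h m (by omega)]
  exact h2 _ le_rfl

end Labels

theorem exists_heaviest_subset (w : ℕ → ℝ) (C : Finset ℕ) {m : ℕ} (hm : m ≤ C.card) :
    ∃ T ⊆ C, T.card = m ∧ ∀ i ∈ T, ∀ j ∈ C, j ∉ T → w j ≤ w i := by
  induction m with
  | zero => exact ⟨∅, by simp⟩
  | succ m ih =>
    obtain ⟨T, hTC, hcard, hT⟩ := ih (by omega)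
    have hne : (C \ T).Nonempty := by
      rw [← Finset.card_pos, Finset.card_sdiff_of_subset hTC]; omega
    obtain ⟨a, ha, hmax⟩ := Finset.exists_max_image (C \ T) w hne
    rw [Finset.mem_sdiff] at ha
    refine ⟨insert a T, Finset.insert_subset ha.1 hTC, by
      rw [Finset.card_insert_of_notMem ha.2, hcard], ?_⟩
    intro i hi j hj hjT
    rw [Finset.mem_insert, not_or] at hjT
    rcases Finset.mem_insert.1 hi with rfl | hi
    · exact hmax j (Finset.mem_sdiff.2 ⟨hj, hjT.2⟩)
    · exact hT i hi j hj hjT.2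

theorem exists_enumeration (A : Finset ℕ) (a n : ℕ) {p : ℕ} (hA : A.card < p) :
    ∃ f : ℕ → ℕ, f 0 = a ∧ (∀ j ∈ A, ∃ i < p, f i = j) ∧ ∀ i, f i = a ∨ f i ∈ A ∨ f i = n := by
  refine ⟨fun i => (a :: A.toList).getD i n, rfl, fun j hj => ?_, fun i => ?_⟩
  · obtain ⟨i, hi, rfl⟩ := List.getElem_of_mem (Finset.mem_toList.2 hj)
    have hi' : i < A.card := by simpa using hi
    exact ⟨i + 1, by omega, by simp [hi']⟩
  · rcases i with _ | i
    · exact .inl rfl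
    · right
      by_cases hi : i < A.card
      · left
        have : A.toList[i]'(by simpa using hi) ∈ A := Finset.mem_toList.1 (List.getElem_mem _)
        simpa [hi] using this
      · right
        simp [hi]

/-- The guess for one class `C` of items: the set `T` of its `p` heaviest items, the lightest of
them listed first. A class of fewer than `p` items is guessed in full, and the first entry is then
the dummy item `n`, which has weight `0`. -/
theorem exists_class_guess {n p : ℕ} (hp : 1 ≤ p) {w : ℕ → ℝ} (hw : ∀ j, 0 ≤ w j) (hn : w n = 0)
    (C : Finset ℕ) :
    ∃ (f : ℕ → ℕ) (T : Finset ℕ), T ⊆ C ∧ (∀ i, f i ∈ T ∨ f i = n) ∧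
      (∀ j ∈ T, ∃ i < p, f i = j) ∧ (∀ j ∈ C, j ∉ T → w j ≤ w (f 0)) ∧
      (∀ i ∈ T, w (f 0) ≤ w i) ∧ (T.card = p ∨ w (f 0) = 0) := by
  by_cases h : p ≤ C.card
  · obtain ⟨T, hTC, hcard, hT⟩ := exists_heaviest_subset w C h
    obtain ⟨a, ha, hmin⟩ := Finset.exists_min_image T w (Finset.card_pos.1 (by omega))
    have hcard' := Finset.card_erase_of_mem ha
    obtain ⟨f, hf0, hf1, hf2⟩ := exists_enumeration (T.erase a) a n (p := p) (by omega)
    refine ⟨f, T, hTC, fun i => ?_, fun j hj => ?_, ?_, ?_, .inl hcard⟩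
    · rcases hf2 i with h | h | h
      · exact .inl (h ▸ ha)
      · exact .inl (Finset.mem_of_mem_erase h)
      · exact .inr h
    · by_cases hja : j = a
      · exact ⟨0, by omega, hf0.trans hja.symm⟩
      · exact hf1 j (Finset.mem_erase.2 ⟨hja, hj⟩)
    · rw [hf0]; exact hT a ha
    · rw [hf0]; exact hmin
  · obtain ⟨f, hf0, hf1, hf2⟩ := exists_enumeration C n n (p := p) (by omega)
    refine ⟨f, C, subset_rfl, fun i => ?_, hf1, fun j hj hj' => absurd hj hj', ?_, ?_⟩
    · rcases hf2 i with h | h | h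
      · exact .inr h
      · exact .inl h
      · exact .inr h
    · rw [hf0, hn]; exact fun i _ => hw i
    · rw [hf0, hn]; exact .inr rfl

/-- The exchange argument: in a set of items of total label less than `p`, items outside of the
guessed sets `T k` can be traded for guessed ones without losing weight. -/
theorem exists_exchange {p b : ℕ} {w : ℕ → ℝ} {c : ℕ → ℕ} {τ : ℕ → ℝ} {T : ℕ → Finset ℕ}
    (hb : b < p) (hT : ∀ k < p, ∀ i ∈ T k, c i = k + 1 ∧ τ k ≤ w i)
    (hfull : ∀ k < p, (T k).card = p ∨ τ k = 0)
    (hc : ∀ j, c j ≤ p) (hτ : ∀ j k, (∀ k < p, j ∉ T k) → c j = k + 1 → w j ≤ τ k)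
    (S : Finset ℕ) (hS : ∀ j ∈ S, 0 < c j) (hSb : ∑ j ∈ S, c j ≤ b) :
    ∃ S' ⊆ (Finset.range p).biUnion T, ∑ j ∈ S', c j ≤ b ∧ ∑ j ∈ S, w j ≤ ∑ j ∈ S', w j := by
  set U := (Finset.range p).biUnion T with hU
  induction hm : (S \ U).card generalizing S with
  | zero => exact ⟨S, Finset.sdiff_eq_empty_iff_subset.1 (Finset.card_eq_zero.1 hm), hSb, le_rfl⟩
  | succ m ih =>
    obtain ⟨j, hj⟩ : (S \ U).Nonempty := Finset.card_pos.1 (by omega)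
    obtain ⟨hjS, hjU⟩ := Finset.mem_sdiff.1 hj
    obtain ⟨k, hk⟩ : ∃ k, c j = k + 1 := ⟨c j - 1, by have := hS j hjS; omega⟩
    have hkp : k < p := by have := hc j; omega
    have hjT : ∀ k < p, j ∉ T k := fun k hk h =>
      hjU (Finset.mem_biUnion.2 ⟨k, Finset.mem_range.2 hk, h⟩)
    have hwj := hτ j k hjT hk
    have hcS := Finset.add_sum_erase S c hjS
    have hwS := Finset.add_sum_erase S w hjS
    have hcard : ((S.erase j) \ U).card = m := by
      rw [Finset.erase_sdiff_comm, Finset.card_erase_of_mem hj]; omega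
    rcases hfull k hkp with hfull | h0
    · have hlt : S.card < (T k).card := by
        have : S.card ≤ ∑ j ∈ S, c j := by
          rw [Finset.card_eq_sum_ones]; exact Finset.sum_le_sum hS
        omega
      obtain ⟨i, hiT, hiS⟩ := Finset.exists_mem_notMem_of_card_lt_card hlt
      have hi' : i ∉ S.erase j := fun h => hiS (Finset.mem_of_mem_erase h)
      have hiU : i ∈ U := Finset.mem_biUnion.2 ⟨k, Finset.mem_range.2 hkp, hiT⟩
      obtain ⟨hci, hwi⟩ := hT k hkp i hiT
      obtain ⟨S', h1, h2, h3⟩ := ih (insert i (S.erase j))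
        (fun l hl => by
          rcases Finset.mem_insert.1 hl with rfl | hl
          · omega
          · exact hS l (Finset.mem_of_mem_erase hl))
        (by rw [Finset.sum_insert hi']; omega)
        (by rw [Finset.insert_sdiff_of_mem _ hiU, hcard])
      rw [Finset.sum_insert hi'] at h3
      exact ⟨S', h1, h2, by linarith⟩
    · obtain ⟨S', h1, h2, h3⟩ := ih (S.erase j)
        (fun l hl => hS l (Finset.mem_of_mem_erase hl)) (by omega) hcard
      exact ⟨S', h1, h2, by linarith⟩

/-- For every valid inequality `α ≥ b + 1` there is a guess such that the support of `α` may be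
replaced by any set `N` of labelled items which is at least as heavy: the labels on `N` are again
the coefficients of a valid inequality with right-hand side `b + 1`. The labels are at most `α` on
the support of `α`. -/
theorem exists_guess {n p b : ℕ} (hp : 1 ≤ p) {w : ℕ → ℝ} (hw : ∀ j, 0 ≤ w j) (hn : w n = 0)
    {w₀ : ℝ} {α : ℕ → ℕ} (hα : ∀ j, α j ≤ p) (hb : b < p)
    (hvalid : ∀ S ⊆ Finset.range n, ∑ j ∈ S, α j ≤ b → ∑ j ∈ S, w j < w₀) :
    ∃ g : ℕ → ℕ, (∀ d, g d ≤ n) ∧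
      (∀ j < n, 0 < α j → 0 < label p w g j ∧ label p w g j ≤ α j) ∧
      ∀ N ⊆ Finset.range n,
        ∑ j ∈ Finset.range n with 0 < α j, w j ≤
          ∑ j ∈ N, (if label p w g j = 0 then 0 else w j) →
        ∀ S ⊆ Finset.range n, ∑ j ∈ S, (if j ∈ N then label p w g j else 0) ≤ b →
          ∑ j ∈ S, w j < w₀ := by
  have hC := fun k => exists_class_guess hp hw hn
    ((Finset.range n).filter fun j => α j = k + 1)
  choose f T hTC hfT hTf hout hin hfull using hC
  have hTα : ∀ {k i}, i ∈ T k → i < n ∧ α i = k + 1 := fun h => by simpa using hTC _ h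
  set g : ℕ → ℕ := fun d => f (d / p) (d % p) with hg
  have hg0 : ∀ k, g (k * p) = f k 0 := fun k => by
    simp [hg, Nat.mul_div_cancel k (show 0 < p by omega)]
  set c := label p w g with hc
  -- Guessed items are labelled with their own coefficient.
  have hcT : ∀ k < p, ∀ i ∈ T k, c i = k + 1 := by
    intro k hk i hi
    obtain ⟨r, hr, hri⟩ := hTf k i hi
    apply guessLabel_eq
    · refine ⟨k * p + r, ?_, ?_⟩
      · nlinarith
      · have h1 : (k * p + r) / p = k := by
          rw [mul_comm, Nat.mul_add_div (by omega), Nat.div_eq_of_lt hr, add_zero]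
        have h2 : (k * p + r) % p = r := by
          rw [mul_comm, Nat.mul_add_mod, Nat.mod_eq_of_lt hr]
        simp only [hg, h1, h2, hri]
    · intro d _ hdi
      rcases hfT (d / p) (d % p) with h | h
      · have h1 := hTα (show i ∈ T (d / p) from hdi ▸ h)
        have h2 := hTα hi
        omega
      · have h1 : i = n := hdi.symm.trans h
        have h2 := hTα hi
        omega
  have hcout : ∀ j ≠ n, (∀ k < p, j ∉ T k) → c j = classLabel p w g j p := by
    intro j hj hjT
    refine guessLabel_of_forall_ne fun d hd hdj => ?_
    rcases hfT (d / p) (d % p) with h | h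
    · exact hjT (d / p) (Nat.div_lt_of_lt_mul hd) (hdj ▸ h)
    · exact hj (hdj.symm.trans h)
  have hsupp : ∀ j < n, 0 < α j → 0 < c j ∧ c j ≤ α j := by
    intro j hj hαj
    obtain ⟨k, hk⟩ : ∃ k, α j = k + 1 := ⟨α j - 1, by omega⟩
    have hkp : k < p := by have := hα j; omega
    by_cases hjT : j ∈ T k
    · rw [hcT k hkp j hjT]; omega
    · have hjT' : ∀ k' < p, j ∉ T k' := fun k' _ h => by
        have := (hTα h).2
        obtain rfl : k' = k := by omega
        exact hjT h
      rw [hcout j hj.ne hjT', hk]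
      exact classLabel_pos hkp (by rw [hg0]; exact hout k j (by simp [hj, hk]) hjT)
  refine ⟨g, fun d => ?_, hsupp, ?_⟩
  · rcases hfT (d / p) (d % p) with h | h
    · exact (hTα h).1.le
    · exact h.le
  intro N hN hNw S hS hSb
  set S₁ := S.filter (fun j => j ∈ N ∧ 0 < c j) with hS₁
  have hS₁b : ∑ j ∈ S₁, c j ≤ b := by
    refine le_trans (le_of_eq ?_) ((Finset.sum_le_sum_of_subset
      (Finset.filter_subset (fun j => j ∈ N ∧ 0 < c j) S)).trans hSb)
    refine Finset.sum_congr rfl fun j hj => ?_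
    rw [if_pos (Finset.mem_filter.1 hj).2.1]
  have hS₁n : ∀ j ∈ S₁, j < n := fun j hj => Finset.mem_range.1 (hS (Finset.mem_filter.1 hj).1)
  obtain ⟨S₂, hS₂, hS₂b, hS₂w⟩ := exists_exchange (w := w)
    (c := fun j => if j < n then c j else 0) (τ := fun k => w (f k 0))
    (T := T) hb (fun k hk i hi => ⟨by
        simp only [if_pos (hTα hi).1]; exact hcT k hk i hi, hin k i hi⟩) (fun k _ => hfull k)
    (fun j => by split; exacts [label_le p w g j, by omega]) (fun j k hj hk => by
      split at hk
      next hjn =>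
        rw [hcout j hjn.ne hj] at hk
        rw [← hg0]
        exact weight_le_of_classLabel hk
      next => omega) S₁
    (fun j hj => by
      simp only [if_pos (hS₁n j hj)]; exact (Finset.mem_filter.1 hj).2.2)
    (by rwa [Finset.sum_congr rfl fun j hj => if_pos (hS₁n j hj)])
  have hS₂α : ∀ j ∈ S₂, j < n ∧ 0 < α j ∧ α j = if j < n then c j else 0 := by
    intro j hj
    obtain ⟨k, hk, hjT⟩ := Finset.mem_biUnion.1 (hS₂ hj)
    have h1 := hTα hjT
    rw [if_pos h1.1, hcT k (Finset.mem_range.1 hk) j hjT]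
    omega
  set Z := (Finset.range n).filter (fun j => ¬ 0 < α j) with hZ
  have hdisj : Disjoint S₂ Z := by
    rw [Finset.disjoint_left]
    intro j hj hjZ
    exact (Finset.mem_filter.1 hjZ).2 (hS₂α j hj).2.1
  have h := hvalid (S₂ ∪ Z)
    (Finset.union_subset (fun j hj => Finset.mem_range.2 (hS₂α j hj).1) (Finset.filter_subset _ _))
    (by
      rw [Finset.sum_union hdisj, Finset.sum_congr rfl fun j hj => (hS₂α j hj).2.2]
      have : ∑ j ∈ Z, α j = 0 := Finset.sum_eq_zero fun j hj => by
        have := (Finset.mem_filter.1 hj).2; omega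
      omega)
  rw [Finset.sum_union hdisj] at h
  have h1 := Finset.sum_filter_add_sum_filter_not (Finset.range n) (fun j => 0 < α j) w
  have h2 := Finset.sum_filter_add_sum_filter_not (Finset.range n) (fun j => j ∈ N ∧ 0 < c j) w
  have h3 := Finset.sum_filter_add_sum_filter_not S (fun j => j ∈ N ∧ 0 < c j) w
  have h4 : ∑ j ∈ S with ¬ (j ∈ N ∧ 0 < c j), w j ≤
      ∑ j ∈ Finset.range n with ¬ (j ∈ N ∧ 0 < c j), w j :=
    Finset.sum_le_sum_of_subset_of_nonneg (Finset.filter_subset_filter _ hS) fun j _ _ => hw j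
  have h5 : ∑ j ∈ N, (if c j = 0 then 0 else w j) =
      ∑ j ∈ Finset.range n with (j ∈ N ∧ 0 < c j), w j := by
    rw [← Finset.filter_filter, Finset.filter_mem_eq_inter, Finset.inter_eq_right.2 hN,
      Finset.sum_filter]
    refine Finset.sum_congr rfl fun j _ => ?_
    by_cases h0 : c j = 0
    · simp [h0]
    · simp [h0, Nat.pos_of_ne_zero h0]
  linarith

/-- The rounding error: with costs `c j * q j`, where `q j` is `n * p * x j / ε` rounded down, a set
`N'` not more expensive than `N` exceeds `N` in true cost by at most `ε`. -/
theorem rounded_cost_le {n p : ℕ} (hp : 1 ≤ p) {ε : ℝ} (hε : 0 < ε) {x : ℕ → ℝ} {c q : ℕ → ℕ}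
    (hc : ∀ j, c j ≤ p) (hq : ∀ j < n, q j * ε ≤ n * p * x j)
    (hq' : ∀ j < n, n * p * x j ≤ (q j + 1) * ε) {N N' : Finset ℕ} (hN : N ⊆ Finset.range n)
    (hN' : N' ⊆ Finset.range n) (h : ∑ j ∈ N', c j * q j ≤ ∑ j ∈ N, c j * q j) :
    ∑ j ∈ N', (c j : ℝ) * x j ≤ ∑ j ∈ N, (c j : ℝ) * x j + ε := by
  rcases Nat.eq_zero_or_pos n with rfl | hn
  · obtain rfl : N = ∅ := by simpa using hN
    obtain rfl : N' = ∅ := by simpa using hN'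
    simpa using hε.le
  have hnp : (0 : ℝ) < n * p := by positivity
  have h1 : (n * p : ℝ) * ∑ j ∈ N', (c j : ℝ) * x j ≤ ε * ∑ j ∈ N', (c j * q j : ℝ) + n * p * ε := by
    calc (n * p : ℝ) * ∑ j ∈ N', (c j : ℝ) * x j
        = ∑ j ∈ N', (c j : ℝ) * (n * p * x j) := by
          rw [Finset.mul_sum]; exact Finset.sum_congr rfl fun j _ => by ring
      _ ≤ ∑ j ∈ N', (ε * (c j * q j) + p * ε) := by
          refine Finset.sum_le_sum fun j hj => ?_
          have h2 := hq' j (Finset.mem_range.1 (hN' hj))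
          have h3 : (c j : ℝ) ≤ p := by exact_mod_cast hc j
          have h4 : (0 : ℝ) ≤ c j := by positivity
          nlinarith
      _ = ε * ∑ j ∈ N', (c j * q j : ℝ) + N'.card * (p * ε) := by
          rw [Finset.sum_add_distrib, Finset.mul_sum]; simp
      _ ≤ _ := by
          have : (N'.card : ℝ) ≤ n := by
            exact_mod_cast (Finset.card_le_card hN').trans (by simp)
          have h5 : 0 ≤ p * ε := by positivity
          nlinarith
  have h2 : ε * ∑ j ∈ N, (c j * q j : ℝ) ≤ (n * p : ℝ) * ∑ j ∈ N, (c j : ℝ) * x j := by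
    rw [Finset.mul_sum, Finset.mul_sum]
    refine Finset.sum_le_sum fun j hj => ?_
    have h2 := hq j (Finset.mem_range.1 (hN hj))
    have h4 : (0 : ℝ) ≤ c j := by positivity
    nlinarith
  have h3 : (∑ j ∈ N', (c j * q j : ℝ)) ≤ ∑ j ∈ N, (c j * q j : ℝ) := by exact_mod_cast h
  refine le_of_mul_le_mul_left ?_ hnp
  nlinarith

/-! ### Candidate inequalities -/

/-- `a` are the coefficients of a candidate inequality for labels `c`, rounded costs `κ`, values `v`
and cost level `l`: the labels on a set of items that is optimal in the knapsack problem. -/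
def IsCandidate (n : ℕ) (c κ : ℕ → ℕ) (v : ℕ → ℝ) (l : ℕ) (a : ℕ → ℕ) : Prop :=
  ∃ N ⊆ Finset.range n, ∑ j ∈ N, κ j ≤ l ∧ ∑ j ∈ N, v j = knapsack κ v n l ∧
    ∀ j < n, a j = if j ∈ N then c j else 0

/-- The inequality `∑ a j * x j ≥ b` has a positive right-hand side, is valid, as certified by the
knapsack recursion with costs `a`, and is violated by `x`. -/
def Passes (n : ℕ) (w : ℕ → ℝ) (w₀ : ℝ) (x : ℕ → ℝ) (a : ℕ → ℕ) (b : ℕ) : Prop :=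
  1 ≤ b ∧ knapsack a w n (b - 1) < w₀ ∧ ∑ j ∈ Finset.range n, (a j : ℝ) * x j < b

/-- If some valid inequality is violated by more than `ε`, then for some guess of items and cost
level every candidate passes the tests. -/
theorem exists_passing_guess {n p K b : ℕ} (hp : 1 ≤ p) {ε : ℝ} (hε : 0 < ε)
    {w x : ℕ → ℝ} (hw : ∀ j, 0 ≤ w j) (hn : w n = 0) {w₀ : ℝ} (hx0 : ∀ j, 0 ≤ x j)
    (hx1 : ∀ j, x j ≤ 1) (hK : 1 ≤ K * ε) {q : ℕ → ℕ}
    (hq : ∀ j < n, q j * ε ≤ n * p * x j) (hq' : ∀ j < n, n * p * x j ≤ (q j + 1) * ε)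
    {α : ℕ → ℕ} (hα : ∀ j, α j ≤ p) (hb1 : 1 ≤ b) (hb : b ≤ p)
    (hvalid : ∀ S ⊆ Finset.range n, ∑ j ∈ S, α j ≤ b - 1 → ∑ j ∈ S, w j < w₀)
    (hviol : ∑ j ∈ Finset.range n, (α j : ℝ) * x j < b - ε) :
    ∃ (g : ℕ → ℕ) (l : ℕ), (∀ d, g d ≤ n) ∧ l ≤ n * n * K * (p * p) ∧
      ∀ a, IsCandidate n (label p w g) (fun j => label p w g j * q j)
        (fun j => if label p w g j = 0 then 0 else w j) l a → Passes n w w₀ x a b := by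
  obtain ⟨g, hgn, hsupp, hrep⟩ := exists_guess hp hw hn hα (b := b - 1) (by omega) hvalid
  set c := label p w g with hc
  set N := (Finset.range n).filter (fun j => 0 < α j) with hN
  have hNn : N ⊆ Finset.range n := Finset.filter_subset _ _
  have hNα : ∀ j ∈ N, 0 < c j ∧ c j ≤ α j := fun j hj => by
    obtain ⟨h1, h2⟩ := Finset.mem_filter.1 hj
    exact hsupp j (Finset.mem_range.1 h1) h2
  have hqK : ∀ j < n, q j ≤ n * p * K := by
    intro j hj
    have h1 := hq j hj
    have h2 : (q j : ℝ) * ε ≤ (n * p * K : ℝ) * ε := by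
      have h3 : (0 : ℝ) ≤ n * p := by positivity
      nlinarith [mul_le_mul_of_nonneg_left (hx1 j) h3, mul_le_mul_of_nonneg_left hK h3]
    exact_mod_cast le_of_mul_le_mul_right h2 hε
  refine ⟨g, ∑ j ∈ N, c j * q j, hgn, ?_, ?_⟩
  · calc ∑ j ∈ N, c j * q j ≤ ∑ j ∈ N, p * (n * p * K) := Finset.sum_le_sum fun j hj =>
          Nat.mul_le_mul (label_le p w g j) (hqK j (Finset.mem_range.1 (hNn hj)))
      _ = N.card * (p * (n * p * K)) := by simp
      _ ≤ n * (p * (n * p * K)) :=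
          Nat.mul_le_mul_right _ ((Finset.card_le_card hNn).trans (by simp))
      _ = n * n * K * (p * p) := by ring
  · rintro a ⟨N', hN', hcost, hval, ha⟩
    have hopt := le_knapsack (v := fun j => if c j = 0 then 0 else w j) hNn
      (le_refl (∑ j ∈ N, c j * q j))
    rw [← hval, Finset.sum_congr rfl fun j hj => if_neg (hNα j hj).1.ne'] at hopt
    refine ⟨hb1, ?_, ?_⟩
    · obtain ⟨S, hS, h1, h2⟩ := exists_knapsack_eq a w n (b - 1)
      rw [← h2]
      refine hrep N' hN' hopt S hS ?_
      rwa [← Finset.sum_congr rfl fun j hj => ha j (Finset.mem_range.1 (hS hj))]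
    · have h1 := rounded_cost_le hp hε (label_le p w g) hq hq' hNn hN' hcost
      have h2 : ∑ j ∈ Finset.range n, (a j : ℝ) * x j = ∑ j ∈ N', (c j : ℝ) * x j := by
        rw [← Finset.sum_subset hN']
        · refine Finset.sum_congr rfl fun j hj => ?_
          rw [ha j (Finset.mem_range.1 (hN' hj)), if_pos hj]
        · intro j hj hj'
          rw [ha j (Finset.mem_range.1 hj), if_neg hj']; simp
      have h3 : ∑ j ∈ N, (c j : ℝ) * x j ≤ ∑ j ∈ Finset.range n, (α j : ℝ) * x j := by
        refine (Finset.sum_le_sum fun j hj => ?_).trans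
          (Finset.sum_le_sum_of_subset_of_nonneg hNn fun j _ _ => by
            have := hx0 j; positivity)
        have : (c j : ℝ) ≤ α j := by exact_mod_cast (hNα j hj).2
        exact mul_le_mul_of_nonneg_right this (hx0 j)
      linarith

namespace RAM

/-- Cell `0` of an integer array, as an expression. -/
def cell (a : ℕ) : IExp := .get a (.lit 0)

@[simp] theorem cell_val (a : ℕ) (s : Store) : (cell a).val s = s.nat a 0 := rfl

namespace Cmd

/-! ### Labelling the items -/

/-- Give label `k`, with the rounded cost and the value that go with it, to the item in `9[0]`. -/
def assign (k : ℕ) : Cmd :=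
  .seq (.iset 7 (cell 9) (.lit k)) (.seq (.iset 8 (cell 9) (.nsmul k (.get 6 (cell 9))))
    (.rset 7 (cell 9) (if k = 0 then .lit 0 else .get 0 (cell 9))))

/-- Computes `classLabel` for the item in `9[0]`. -/
def classCmd (p : ℕ) : ℕ → Cmd
  | 0 => assign 0
  | k + 1 => .seq (classCmd p k)
      (.ite (.and (.ile (.get 7 (cell 9)) (.lit 0))
        (.rle (.get 0 (cell 9)) (.get 0 (cell (20 + k * p))))) (assign (k + 1)) .skip)

/-- Computes `guessLabel` for the item in `9[0]`. -/
def guessCmd (p : ℕ) : ℕ → Cmd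
  | 0 => classCmd p p
  | d + 1 => .seq (guessCmd p d)
      (.ite (.and (.ile (cell (20 + d)) (cell 9)) (.ile (cell 9) (cell (20 + d))))
        (assign (d / p + 1)) .skip)

/-- Labels all items. -/
def labelCmd (p : ℕ) : Cmd := .rep 9 0 (guessCmd p (p * p))

end Cmd

/-- The memory state after item `j` has been given label `k`. -/
noncomputable def Store.label (s : Store) (j k : ℕ) : Store :=
  ((s.setNat 7 j k).setNat 8 j (k * s.nat 6 j)).setNum 7 j (if k = 0 then 0 else s.num 0 j)

theorem Store.label_nat_of_ne (s : Store) (j k : ℕ) {a : ℕ} (h7 : a ≠ 7) (h8 : a ≠ 8) :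
    (s.label j k).nat a = s.nat a := by
  funext i; simp [Store.label, h7, h8]

theorem Store.label_num_of_ne (s : Store) (j k : ℕ) {a : ℕ} (h7 : a ≠ 7) :
    (s.label j k).num a = s.num a := by
  funext i; simp [Store.label, h7]

theorem Store.label_label (s : Store) (j k k' : ℕ) :
    (s.label j k).label j k' = s.label j k' := by
  simp only [Store.label, Store.setNat, Store.setNum, Store.mk.injEq]
  constructor <;> funext a i <;> by_cases ha : a = 7 <;> by_cases ha' : a = 8 <;>
    by_cases hi : i = j <;> simp_all

namespace Cmd

theorem assign_run (k : ℕ) (s : Store) : (assign k).run s = s.label (s.nat 9 0) k := by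
  by_cases hk : k = 0 <;>
    simp [assign, run, Store.label, IExp.val, RExp.val, hk]

theorem classCmd_run (p m : ℕ) (s : Store) : (classCmd p m).run s =
    s.label (s.nat 9 0) (classLabel p (s.num 0) (fun d => s.nat (20 + d) 0) (s.nat 9 0) m) := by
  induction m with
  | zero => rw [classCmd, assign_run]; rfl
  | succ m ih =>
    have h7 : ∀ j k, (s.label j k).nat 7 j = k := by simp [Store.label]
    have h20 : 20 + m * p ≠ 7 ∧ 20 + m * p ≠ 8 := by omega
    simp only [classCmd, run, ih, classLabel, assign_run, Test.holds, IExp.val, RExp.val, cell_val,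
      Store.label_nat_of_ne _ _ _ (show 9 ≠ 7 by decide) (show 9 ≠ 8 by decide),
      Store.label_nat_of_ne _ _ _ h20.1 h20.2, Store.label_num_of_ne _ _ _ (show 0 ≠ 7 by decide),
      h7, Nat.le_zero]
    split
    · rw [Store.label_label]
    · rfl

theorem guessCmd_run (p m : ℕ) (s : Store) : (guessCmd p m).run s =
    s.label (s.nat 9 0) (guessLabel p (s.num 0) (fun d => s.nat (20 + d) 0) (s.nat 9 0) m) := by
  induction m with
  | zero => exact classCmd_run p p s
  | succ m ih =>
    have h20 : 20 + m ≠ 7 ∧ 20 + m ≠ 8 := by omega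
    simp only [guessCmd, run, ih, guessLabel, assign_run, Test.holds, cell_val,
      Store.label_nat_of_ne _ _ _ (show 9 ≠ 7 by decide) (show 9 ≠ 8 by decide),
      Store.label_nat_of_ne _ _ _ h20.1 h20.2, ← le_antisymm_iff]
    split
    · rw [Store.label_label]
    · rfl

theorem guessCmd_keeps {a : ℕ} (p m : ℕ) (h7 : a ≠ 7) (h8 : a ≠ 8) : (guessCmd p m).Keeps a := by
  have h : ∀ k, (classCmd p k).Keeps a := by
    intro k
    induction k with
    | zero => simp [classCmd, assign, Keeps, h7, h8]
    | succ k ih => simp [classCmd, assign, Keeps, h7, h8, ih]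
  induction m with
  | zero => exact h p
  | succ m ih => simp [guessCmd, assign, Keeps, h7, h8, ih]

theorem guessCmd_keepsNum {a : ℕ} (p m : ℕ) (h7 : a ≠ 7) : (guessCmd p m).KeepsNum a := by
  have h : ∀ k, (classCmd p k).KeepsNum a := by
    intro k
    induction k with
    | zero => simp [classCmd, assign, KeepsNum, h7]
    | succ k ih => simp [classCmd, assign, KeepsNum, h7, ih]
  induction m with
  | zero => exact h p
  | succ m ih => simp [guessCmd, assign, KeepsNum, h7, ih]

theorem guessCmd_wf (p m : ℕ) : (guessCmd p m).WF := by
  have h : ∀ k, (classCmd p k).WF := by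
    intro k
    induction k with
    | zero => simp [classCmd, assign, WF]
    | succ k ih => simp [classCmd, assign, WF, ih]
  induction m with
  | zero => exact h p
  | succ m ih => simp [guessCmd, assign, WF, ih]

theorem labelCmd_keeps {a : ℕ} (p : ℕ) (h7 : a ≠ 7) (h8 : a ≠ 8) (h9 : a ≠ 9) :
    (labelCmd p).Keeps a := ⟨h9, guessCmd_keeps p _ h7 h8⟩

theorem labelCmd_keepsNum {a : ℕ} (p : ℕ) (h7 : a ≠ 7) : (labelCmd p).KeepsNum a :=
  guessCmd_keepsNum p _ h7

theorem labelCmd_wf (p : ℕ) : (labelCmd p).WF :=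
  ⟨guessCmd_keeps p _ (by decide) (by decide), guessCmd_wf p _⟩

theorem labelCmd_run (p : ℕ) (s : Store) {c : ℕ → ℕ}
    (hc : c = label p (s.num 0) fun d => s.nat (20 + d) 0) :
    ∀ j < s.nat 4 0, ((labelCmd p).run s).nat 7 j = c j ∧
      ((labelCmd p).run s).nat 8 j = c j * s.nat 6 j ∧
      ((labelCmd p).run s).num 7 j = if c j = 0 then 0 else s.num 0 j := by
  subst hc
  refine run_rep (fun i s' => ∀ j < i, s'.nat 7 j = label p (s.num 0) (fun d => s.nat (20 + d) 0) j ∧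
    s'.nat 8 j = label p (s.num 0) (fun d => s.nat (20 + d) 0) j * s.nat 6 j ∧
    s'.num 7 j = if label p (s.num 0) (fun d => s.nat (20 + d) 0) j = 0 then 0 else s.num 0 j)
    (by simp) ?_
  intro i _ s' ih h9 hnat hnum j hj
  have h20 : (fun d => s'.nat (20 + d) 0) = fun d => s.nat (20 + d) 0 := by
    funext d
    rw [hnat _ (by omega) (guessCmd_keeps p _ (by omega) (by omega))]
  rw [guessCmd_run, h9, h20, hnum 0 (guessCmd_keepsNum p _ (by decide))]
  rcases Nat.lt_succ_iff_lt_or_eq.1 hj with hj | rfl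
  · simpa [Store.label, hj.ne] using ih j hj
  · simp [Store.label, label, hnat 6 (by decide) (guessCmd_keeps p _ (by decide) (by decide)),
      hnum 0 (guessCmd_keepsNum p _ (by decide))]
    congr

/-! ### The dynamic programme -/

/-- The address of the entry for cost level `e` in the row of the table that starts at `12[0]`. -/
def entry (e : IExp) : RExp := .get 5 (.add (cell 12) e)

/-- Computes one entry of the table: the one for cost level `11[0]` in the row after the row that
starts at `12[0]`, taking item `10[0]` into account. -/
def knapsackStep (a b : ℕ) : Cmd :=
  .ite (.and (.ile (.get a (cell 10)) (cell 11))
      (.not (.rle (.add (entry (.sub (cell 11) (.get a (cell 10)))) (.get b (cell 10)))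
        (entry (cell 11)))))
    (.rset 5 (.add (.add (cell 12) (.get 4 (.lit 2))) (cell 11))
      (.add (entry (.sub (cell 11) (.get a (cell 10)))) (.get b (cell 10))))
    (.rset 5 (.add (.add (cell 12) (.get 4 (.lit 2))) (cell 11)) (entry (cell 11)))

/-- Fills the dynamic programming table for the costs in the integer array `a` and the values in the
real array `b`. Its rows are stored one after the other. -/
def knapsackCmd (a b : ℕ) : Cmd :=
  .seq (.rep 11 2 (.rset 5 (cell 11) (.lit 0)))
    (.seq (.iset 12 (.lit 0) (.lit 0))
      (.rep 10 0 (.seq (.rep 11 2 (knapsackStep a b))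
        (.iset 12 (.lit 0) (.add (cell 12) (.get 4 (.lit 2)))))))

theorem knapsackCmd_keeps {a : ℕ} (b c : ℕ) (h10 : a ≠ 10) (h11 : a ≠ 11) (h12 : a ≠ 12) :
    (knapsackCmd b c).Keeps a := by
  simp [knapsackCmd, knapsackStep, Keeps, h10, h11, h12]

theorem knapsackCmd_keepsNum {a : ℕ} (b c : ℕ) (h5 : a ≠ 5) : (knapsackCmd b c).KeepsNum a := by
  simp [knapsackCmd, knapsackStep, KeepsNum, h5]

theorem knapsackCmd_wf (b c : ℕ) : (knapsackCmd b c).WF := by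
  simp [knapsackCmd, knapsackStep, WF, Keeps]

theorem knapsackCmd_run {a b : ℕ} (ha10 : a ≠ 10) (ha11 : a ≠ 11) (ha12 : a ≠ 12) (hb : b ≠ 5)
    (s : Store) : ((knapsackCmd a b).run s).nat 12 0 = s.nat 4 0 * s.nat 4 2 ∧
      ∀ j ≤ s.nat 4 0, ∀ l < s.nat 4 2, ((knapsackCmd a b).run s).num 5 (j * s.nat 4 2 + l) =
        knapsack (s.nat a) (s.num b) j l := by
  have hbody : ∀ s : Store, ∀ i : ℕ, s.nat 10 0 = i → s.nat 12 0 = i * s.nat 4 2 →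
      (∀ j ≤ i, ∀ l < s.nat 4 2,
        s.num 5 (j * s.nat 4 2 + l) = knapsack (s.nat a) (s.num b) j l) →
      ∀ j ≤ i + 1, ∀ l < s.nat 4 2, ((rep 11 2 (knapsackStep a b)).run s).num 5
        (j * s.nat 4 2 + l) = knapsack (s.nat a) (s.num b) j l := by
    intro s i hi hr hs
    have key := run_rep (v := 11) (k := 2) (c := knapsackStep a b) (s := s)
      (fun m s' => ∀ j l, l < s.nat 4 2 → (j ≤ i ∨ j = i + 1 ∧ l < m) →
        s'.num 5 (j * s.nat 4 2 + l) = knapsack (s.nat a) (s.num b) j l)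
      (fun j l hl hj => hs j (hj.resolve_right fun h => absurd h.2 (Nat.not_lt_zero l)) l hl) ?_
    · intro j hj l hl
      have hj' : j ≤ i ∨ j = i + 1 ∧ l < s.nat 4 2 := by omega
      exact key j l hl hj'
    intro m hm s' ih h11 hnat hnum j l hl hj
    have e4 := hnat 4 (by decide) (by simp [knapsackStep, Keeps])
    have e10 := hnat 10 (by decide) (by simp [knapsackStep, Keeps])
    have e12 := hnat 12 (by decide) (by simp [knapsackStep, Keeps])
    have ea := hnat a ha11 (by simp [knapsackStep, Keeps])
    have eb := hnum b (by simp [knapsackStep, KeepsNum, hb])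
    have hrow : ∀ l < s.nat 4 2, s'.num 5 (i * s.nat 4 2 + l) =
        knapsack (s.nat a) (s.num b) i l := fun l hl => ih i l hl (.inl le_rfl)
    have hstep : (knapsackStep a b).run s' =
        s'.setNum 5 (i * s.nat 4 2 + s.nat 4 2 + m) (knapsack (s.nat a) (s.num b) (i + 1) m) := by
      simp only [knapsackStep, entry, run, Test.holds, IExp.val, RExp.val, cell_val, e4, e10, e12,
        ea, eb, h11, hi, hr, hrow m hm, hrow (m - s.nat a i) (by omega), knapsack, not_le]
      split <;> rfl
    rw [Store.setNat_num, hstep, Store.setNum_num]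
    have hrows : (i + 1) * s.nat 4 2 = i * s.nat 4 2 + s.nat 4 2 := by ring
    rcases hj with hj | ⟨rfl, hj⟩
    · have h1 : j * s.nat 4 2 ≤ i * s.nat 4 2 := Nat.mul_le_mul_right _ hj
      rw [if_neg (by omega)]
      exact ih j l hl (.inl hj)
    · by_cases hlm : l = m
      · rw [if_pos (by omega), hlm]
      · rw [if_neg (by omega)]
        exact ih _ l hl (.inr ⟨rfl, by omega⟩)
  -- The state in which the loop over the items starts.
  obtain ⟨s₁, hs₁⟩ : ∃ s₁, s₁ =
      ((rep 11 2 (.rset 5 (cell 11) (.lit 0))).run s).setNat 12 0 0 := ⟨_, rfl⟩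
  have hrun : (knapsackCmd a b).run s = (rep 10 0 (.seq (.rep 11 2 (knapsackStep a b))
        (.iset 12 (.lit 0) (.add (cell 12) (.get 4 (.lit 2)))))).run s₁ := by rw [hs₁]; rfl
  have hzero : ∀ l < s.nat 4 2, s₁.num 5 l = 0 := by
    rw [hs₁, Store.setNat_num]
    refine run_rep (fun m s' => ∀ l < m, s'.num 5 l = 0) (by simp) ?_
    intro m _ s' ih h11 _ _ l hl
    simp only [run, cell_val, h11, RExp.val, Store.setNat_num, Store.setNum_num]
    split
    next => simp
    next h => exact ih l (lt_of_le_of_ne (Nat.lt_succ_iff.1 hl) fun e => h ⟨trivial, e⟩)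
  have hn : ∀ c, c ≠ 11 → c ≠ 12 → s₁.nat c = s.nat c := fun c h11 h12 => by
    rw [hs₁, Store.setNat_nat_of_ne _ _ _ h12, run_nat (by simp [Keeps, h11])]
  have hv : s₁.num b = s.num b := by
    rw [hs₁, Store.setNat_num, run_num (by simp [KeepsNum, hb])]
  have hr : s₁.nat 12 0 = 0 := by simp [hs₁]
  rw [hrun, ← hn 4 (by decide) (by decide), ← hv, ← hn a ha11 ha12]
  rw [← hn 4 (by decide) (by decide)] at hzero
  refine run_rep (fun i s' => s'.nat 12 0 = i * s₁.nat 4 2 ∧ ∀ j ≤ i, ∀ l < s₁.nat 4 2,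
    s'.num 5 (j * s₁.nat 4 2 + l) = knapsack (s₁.nat a) (s₁.num b) j l) ?_ ?_
  · refine ⟨by simp [hr], fun j hj l hl => ?_⟩
    obtain rfl : j = 0 := by omega
    simpa [knapsack] using hzero l hl
  · rintro i _ s' ⟨ihr, ih⟩ h10 hnat hnum
    have e4 := hnat 4 (by decide) (by simp [knapsackStep, Keeps])
    have ea := hnat a ha10 (by simp [knapsackStep, Keeps, ha11, ha12])
    have eb := hnum b (by simp [knapsackStep, KeepsNum, hb])
    have h := hbody s' i h10 (by rw [e4, ihr]) (by rw [e4, ea, eb]; exact ih)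
    rw [e4, ea, eb] at h
    refine ⟨?_, ?_⟩
    · have k4 : ((rep 11 2 (knapsackStep a b)).run s').nat 4 = s'.nat 4 :=
        run_nat (by simp [knapsackStep, Keeps]) _
      have k12 : ((rep 11 2 (knapsackStep a b)).run s').nat 12 = s'.nat 12 :=
        run_nat (by simp [knapsackStep, Keeps]) _
      have hseq : (Cmd.seq (.rep 11 2 (knapsackStep a b))
          (.iset 12 (.lit 0) (.add (cell 12) (.get 4 (.lit 2))))).run s' =
          ((rep 11 2 (knapsackStep a b)).run s').setNat 12 0 (((rep 11 2 (knapsackStep a b)).run s').nat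
            12 0 + ((rep 11 2 (knapsackStep a b)).run s').nat 4 2) := rfl
      rw [hseq]
      simp [k4, k12, e4, ihr, add_mul]
    · simpa only [run, Store.setNat_num] using h

/-! ### Reading off the candidate -/

/-- The item visited in round `10[0]` of the backward pass: `n - 1 - 10[0]`. -/
def backItem : IExp := .sub (.sub (.get 4 (.lit 0)) (cell 10)) (.lit 1)

/-- Retraces the decisions of the dynamic programme from cost level `e` and writes the labels of
the chosen items into the integer array `2`. -/
def backtrackCmd (e : IExp) : Cmd :=
  .seq (.iset 13 (.lit 0) e)
    (.rep 10 0 (.seq (.iset 12 (.lit 0) (.sub (cell 12) (.get 4 (.lit 2))))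
      (.ite (.rle (.get 5 (.add (.add (cell 12) (.get 4 (.lit 2))) (cell 13))) (entry (cell 13)))
        (.iset 2 backItem (.lit 0))
        (.seq (.iset 2 backItem (.get 7 backItem))
          (.iset 13 (.lit 0) (.sub (cell 13) (.get 8 backItem)))))))

theorem backtrackCmd_keeps {a : ℕ} (e : IExp) (h2 : a ≠ 2) (h10 : a ≠ 10) (h12 : a ≠ 12)
    (h13 : a ≠ 13) : (backtrackCmd e).Keeps a := by
  simp [backtrackCmd, Keeps, h2, h10, h12, h13]

theorem backtrackCmd_keepsNum (a : ℕ) (e : IExp) : (backtrackCmd e).KeepsNum a := by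
  simp [backtrackCmd, KeepsNum]

theorem backtrackCmd_wf (e : IExp) : (backtrackCmd e).WF := by
  simp [backtrackCmd, WF, Keeps]

/-- If the table for the costs in array `8` is complete and `12[0]` points to its last row, the
backward pass writes a candidate into array `2`. -/
theorem backtrackCmd_run {s : Store} (e : IExp) {n W : ℕ} (hn : s.nat 4 0 = n) (hW : s.nat 4 2 = W)
    (hr : s.nat 12 0 = n * W) {v : ℕ → ℝ}
    (htab : ∀ j ≤ n, ∀ l < W, s.num 5 (j * W + l) = knapsack (s.nat 8) v j l)
    (hl : e.val s < W) :
    IsCandidate n (s.nat 7) (s.nat 8) v (e.val s) (((backtrackCmd e).run s).nat 2) := by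
  set L := e.val s with hL
  set body := Cmd.seq (.iset 12 (.lit 0) (.sub (cell 12) (.get 4 (.lit 2))))
      (.ite (.rle (.get 5 (.add (.add (cell 12) (.get 4 (.lit 2))) (cell 13))) (entry (cell 13)))
        (.iset 2 backItem (.lit 0))
        (.seq (.iset 2 backItem (.get 7 backItem))
          (.iset 13 (.lit 0) (.sub (cell 13) (.get 8 backItem))))) with hbody
  -- After `i` rounds the decisions on the items `j ≥ n - i` are known.
  have key := run_rep (v := 10) (k := 0) (c := body) (s := s.setNat 13 0 L)
    (fun i s' => s'.nat 12 0 = (n - i) * W ∧ ∃ N : Finset ℕ, (∀ j ∈ N, n - i ≤ j ∧ j < n) ∧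
      s'.nat 13 0 + ∑ j ∈ N, s.nat 8 j = L ∧
      knapsack (s.nat 8) v (n - i) (s'.nat 13 0) + ∑ j ∈ N, v j = knapsack (s.nat 8) v n L ∧
      ∀ j < n, n - i ≤ j → s'.nat 2 j = if j ∈ N then s.nat 7 j else 0)
    ⟨by simpa using hr, ∅, by simp, by simp, by simp, fun j h1 h2 => by omega⟩ ?_
  · have hn' : (s.setNat 13 0 L).nat 4 0 = n := by simpa using hn
    rw [hn'] at key
    obtain ⟨-, N, h1, h2, h3, h4⟩ := key
    refine ⟨N, fun j hj => Finset.mem_range.2 (h1 j hj).2, by omega, ?_, fun j hj => ?_⟩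
    · simpa [knapsack] using h3
    · exact h4 j hj (by omega)
  · rintro i hi s' ⟨ihr, N, h1, h2, h3, h4⟩ h10 hnat hnum
    have e4 : s'.nat 4 = s.nat 4 := hnat 4 (by decide) (by simp [hbody, Keeps])
    have e7 : s'.nat 7 = s.nat 7 := hnat 7 (by decide) (by simp [hbody, Keeps])
    have e8 : s'.nat 8 = s.nat 8 := hnat 8 (by decide) (by simp [hbody, Keeps])
    have e5 : s'.num 5 = s.num 5 := hnum 5 (by simp [hbody, KeepsNum])
    replace hi : i < n := by simpa [hn] using hi
    obtain ⟨m, hm⟩ : ∃ m, n = i + 1 + m := ⟨n - i - 1, by omega⟩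
    have hni : n - i = m + 1 := by omega
    have hni' : n - (i + 1) = m := by omega
    have hnm : n - i - 1 = m := by omega
    rw [hni] at ihr h1 h3 h4
    set l := s'.nat 13 0 with hl'
    have hlW : l < W := by omega
    have hrW : (m + 1) * W - W = m * W := by rw [add_mul]; omega
    have hrow : ∀ l < W, s.num 5 (m * W + W + l) = knapsack (s.nat 8) v (m + 1) l := by
      intro l hl
      rw [← htab (m + 1) (by omega) l hl, add_mul, one_mul]
    have hrun : body.run s' = if knapsack (s.nat 8) v (m + 1) l ≤ knapsack (s.nat 8) v m l then
        (s'.setNat 12 0 (m * W)).setNat 2 m 0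
        else ((s'.setNat 12 0 (m * W)).setNat 2 m (s.nat 7 m)).setNat 13 0 (l - s.nat 8 m) := by
      simp [hbody, run, Test.holds, IExp.val, RExp.val, entry, backItem, e4, e5, e7, e8, hn, hW,
        ihr, hrW, h10, hnm, ← hl', htab m (by omega) l hlW, hrow l hlW]
    have hmN : m ∉ N := fun h => by have := (h1 m h).1; omega
    rw [hrun, hni']
    by_cases hle : knapsack (s.nat 8) v (m + 1) l ≤ knapsack (s.nat 8) v m l
    · rw [if_pos hle]
      have heq : knapsack (s.nat 8) v (m + 1) l = knapsack (s.nat 8) v m l := by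
        refine le_antisymm hle ?_
        simp only [knapsack]
        split
        next h => exact h.2.le
        next => exact le_rfl
      refine ⟨by simp, N, fun j hj => ⟨by have := (h1 j hj).1; omega, (h1 j hj).2⟩, ?_, ?_, ?_⟩
      · simpa [← hl'] using h2
      · rw [heq] at h3
        simpa [← hl'] using h3
      · intro j hj hmj
        by_cases hjm : j = m
        · subst hjm; simp [hmN]
        · simpa [hjm] using h4 j hj (by omega)
    · rw [if_neg hle]
      have hcond : s.nat 8 m ≤ l ∧
          knapsack (s.nat 8) v m l < knapsack (s.nat 8) v m (l - s.nat 8 m) + v m := by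
        by_contra h
        simp only [knapsack, if_neg h, le_refl, not_true_eq_false] at hle
      have heq : knapsack (s.nat 8) v (m + 1) l = knapsack (s.nat 8) v m (l - s.nat 8 m) + v m := by
        simp only [knapsack, if_pos hcond]
      refine ⟨by simp, insert m N, ?_, ?_, ?_, ?_⟩
      · intro j hj
        rcases Finset.mem_insert.1 hj with rfl | hj
        · omega
        · have := h1 j hj; omega
      · rw [Finset.sum_insert hmN]
        simp only [Store.setNat_nat]
        simp only [show (13 : ℕ) ≠ 10 by decide, false_and, if_false, and_self, if_true]
        omega
      · rw [Finset.sum_insert hmN]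
        simp only [Store.setNat_nat]
        simp only [show (13 : ℕ) ≠ 10 by decide, false_and, if_false, and_self, if_true]
        rw [heq] at h3
        linarith
      · intro j hj hmj
        by_cases hjm : j = m
        · subst hjm; simp
        · simpa [hjm] using h4 j hj (by omega)

/-! ### Testing the candidate -/

/-- Computes `∑ a j * x j - b` in cell `0` of the real array `6`, for the coefficients in the
integer array `2` and the right-hand side in `3[0]`, all of which are at most `p`. -/
def slackCmd : Cmd :=
  .seq (.rset 6 (.lit 0) (.lit 0))
    (.seq (.rep 10 0 (.rep 11 4 (.ite (.ile (.add (cell 11) (.lit 1)) (.get 2 (cell 10)))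
        (.rset 6 (.lit 0) (.add (.get 6 (.lit 0)) (.get 1 (cell 10)))) .skip)))
      (.rep 11 4 (.ite (.ile (.add (cell 11) (.lit 1)) (cell 3))
        (.rset 6 (.lit 0) (.sub (.get 6 (.lit 0)) (.lit 1))) .skip)))

theorem slackCmd_keeps {a : ℕ} (h10 : a ≠ 10) (h11 : a ≠ 11) : slackCmd.Keeps a := by
  simp [slackCmd, Keeps, h10, h11]

theorem slackCmd_keepsNum {a : ℕ} (h6 : a ≠ 6) : slackCmd.KeepsNum a := by
  simp [slackCmd, KeepsNum, h6]

theorem slackCmd_wf : slackCmd.WF := by simp [slackCmd, WF, Keeps]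

theorem slackCmd_run {s : Store} {n : ℕ} (hn : s.nat 4 0 = n)
    (hc : ∀ j < n, s.nat 2 j ≤ s.nat 4 4) (hb : s.nat 3 0 ≤ s.nat 4 4) :
    (slackCmd.run s).num 6 0 =
      ∑ j ∈ Finset.range n, (s.nat 2 j : ℝ) * s.num 1 j - s.nat 3 0 := by
  have hinner : ∀ s : Store, s.nat 2 (s.nat 10 0) ≤ s.nat 4 4 →
      ((rep 11 4 (.ite (.ile (.add (cell 11) (.lit 1)) (.get 2 (cell 10)))
        (.rset 6 (.lit 0) (.add (.get 6 (.lit 0)) (.get 1 (cell 10)))) .skip)).run s).num 6 0 =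
        s.num 6 0 + s.nat 2 (s.nat 10 0) * s.num 1 (s.nat 10 0) := by
    intro s hle
    have key := run_rep (v := 11) (k := 4)
      (c := .ite (.ile (.add (cell 11) (.lit 1)) (.get 2 (cell 10)))
        (.rset 6 (.lit 0) (.add (.get 6 (.lit 0)) (.get 1 (cell 10)))) .skip) (s := s)
      (fun i s' => s'.num 6 0 = s.num 6 0 +
        (min i (s.nat 2 (s.nat 10 0)) : ℕ) * s.num 1 (s.nat 10 0)) (by simp) ?_
    · rw [key, min_eq_right hle]
    · intro i _ s' ih h11 hnat hnum
      have e2 := hnat 2 (by decide) (by simp [Keeps])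
      have e10 := hnat 10 (by decide) (by simp [Keeps])
      have e1 := hnum 1 (by simp [KeepsNum])
      simp only [run, Test.holds, IExp.val, RExp.val, cell_val, e1, e2, e10, h11,
        Store.setNat_num]
      split
      next h =>
        simp only [Store.setNum_num, and_self, if_true, ih]
        rw [min_eq_left h, min_eq_left (by omega)]
        push_cast; ring
      next h => rw [ih, min_eq_right (by omega), min_eq_right (by omega)]
  obtain ⟨s₁, hs₁⟩ : ∃ s₁, s₁ = (rep 10 0 (.rep 11 4
      (.ite (.ile (.add (cell 11) (.lit 1)) (.get 2 (cell 10)))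
        (.rset 6 (.lit 0) (.add (.get 6 (.lit 0)) (.get 1 (cell 10)))) .skip))).run
          (s.setNum 6 0 0) := ⟨_, rfl⟩
  have hsum : s₁.num 6 0 = ∑ j ∈ Finset.range n, (s.nat 2 j : ℝ) * s.num 1 j := by
    have key := run_rep (v := 10) (k := 0)
      (c := .rep 11 4 (.ite (.ile (.add (cell 11) (.lit 1)) (.get 2 (cell 10)))
        (.rset 6 (.lit 0) (.add (.get 6 (.lit 0)) (.get 1 (cell 10)))) .skip))
      (s := s.setNum 6 0 0)
      (fun i s' => s'.num 6 0 = ∑ j ∈ Finset.range i, (s.nat 2 j : ℝ) * s.num 1 j) (by simp) ?_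
    · rw [← hs₁] at key
      rw [key, Store.setNum_nat, hn]
    · intro i hi s' ih h10 hnat hnum
      have e2 : s'.nat 2 = s.nat 2 := hnat 2 (by decide) (by simp [Keeps])
      have e4 : s'.nat 4 = s.nat 4 := hnat 4 (by decide) (by simp [Keeps])
      have e1 : s'.num 1 = s.num 1 := hnum 1 (by simp [KeepsNum])
      rw [Store.setNat_num, hinner s' (by rw [e2, e4, h10]; exact hc i (by simpa [hn] using hi)),
        e2, e1, h10, ih, Finset.sum_range_succ]
  have e3 : s₁.nat 3 = s.nat 3 := by rw [hs₁, run_nat (by simp [Keeps])]; rfl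
  have e4 : s₁.nat 4 = s.nat 4 := by rw [hs₁, run_nat (by simp [Keeps])]; rfl
  have hrun : slackCmd.run s = (rep 11 4 (.ite (.ile (.add (cell 11) (.lit 1)) (cell 3))
        (.rset 6 (.lit 0) (.sub (.get 6 (.lit 0)) (.lit 1))) .skip)).run s₁ := by
    rw [hs₁]; simp [slackCmd, run, IExp.val, RExp.val]
  rw [hrun]
  have key := run_rep (v := 11) (k := 4) (c := .ite (.ile (.add (cell 11) (.lit 1)) (cell 3))
        (.rset 6 (.lit 0) (.sub (.get 6 (.lit 0)) (.lit 1))) .skip) (s := s₁)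
    (fun i s' => s'.num 6 0 = s₁.num 6 0 - (min i (s.nat 3 0) : ℕ)) (by simp) ?_
  · rw [key, e4, min_eq_right hb, hsum]
  · intro i _ s' ih h11 hnat _
    have e3' := hnat 3 (by decide) (by simp [Keeps])
    simp only [run, Test.holds, IExp.val, RExp.val, cell_val, e3', e3, h11, Store.setNat_num]
    split
    next h =>
      simp only [Store.setNum_num, and_self, if_true, ih]
      rw [min_eq_left h, min_eq_left (by omega)]
      push_cast; ring
    next h => rw [ih, min_eq_right (by omega), min_eq_right (by omega)]

/-- The test whether the candidate passes. -/
def passTest : Test :=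
  .and (.ile (.lit 1) (cell 3))
    (.and (.not (.rle (.get 2 (.lit 0)) (entry (.sub (cell 3) (.lit 1)))))
      (.not (.rle (.lit 0) (.get 6 (.lit 0)))))

/-- Builds the candidate for the current guess and raises the answer flag if it passes. -/
def tryCmd (p : ℕ) : Cmd :=
  .seq (labelCmd p) (.seq (knapsackCmd 8 7) (.seq (backtrackCmd (cell (20 + p * p)))
    (.seq (.iset 3 (.lit 0) (cell (20 + (p * p + 1)))) (.seq (knapsackCmd 2 0) (.seq slackCmd
      (.ite passTest (.iset 1 (.lit 0) (.lit 1)) .skip))))))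

theorem tryCmd_keeps {a : ℕ} (p : ℕ) (ha : a = 0 ∨ a = 4 ∨ a = 5 ∨ a = 6 ∨ 14 ≤ a) :
    (tryCmd p).Keeps a := by
  refine ⟨labelCmd_keeps p ?_ ?_ ?_, knapsackCmd_keeps _ _ ?_ ?_ ?_,
    backtrackCmd_keeps _ ?_ ?_ ?_ ?_, ?_, knapsackCmd_keeps _ _ ?_ ?_ ?_, slackCmd_keeps ?_ ?_, ?_,
    trivial⟩ <;> (try simp only [Keeps]) <;> omega

theorem tryCmd_keepsNum {a : ℕ} (p : ℕ) (ha : a ≤ 3) : (tryCmd p).KeepsNum a := by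
  refine ⟨labelCmd_keepsNum p (by omega), knapsackCmd_keepsNum _ _ (by omega),
    backtrackCmd_keepsNum _ _, trivial, knapsackCmd_keepsNum _ _ (by omega),
    slackCmd_keepsNum (by omega), trivial, trivial⟩

theorem tryCmd_wf (p : ℕ) : (tryCmd p).WF :=
  ⟨labelCmd_wf p, knapsackCmd_wf _ _, backtrackCmd_wf _, trivial, knapsackCmd_wf _ _, slackCmd_wf,
    trivial, trivial⟩

/-- The array `2` receives a candidate for the current guess, and the flag is raised exactly if it
passes. -/
theorem tryCmd_run {p n : ℕ} {s : Store} (hn : s.nat 4 0 = n) (hp : s.nat 4 4 = p + 1)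
    (hl : s.nat (20 + p * p) 0 < s.nat 4 2) (hb : s.nat (20 + (p * p + 1)) 0 < p + 1)
    (hW : p + 1 ≤ s.nat 4 2) {c : ℕ → ℕ}
    (hc : c = label p (s.num 0) fun d => s.nat (20 + d) 0) :
    IsCandidate n c (fun j => c j * s.nat 6 j) (fun j => if c j = 0 then 0 else s.num 0 j)
        (s.nat (20 + p * p) 0) (((tryCmd p).run s).nat 2) ∧
      ((tryCmd p).run s).nat 3 0 = s.nat (20 + (p * p + 1)) 0 ∧
      (Passes n (s.num 0) (s.num 2 0) (s.num 1) (((tryCmd p).run s).nat 2)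
          (((tryCmd p).run s).nat 3 0) → ((tryCmd p).run s).nat 1 0 = 1) ∧
      (¬ Passes n (s.num 0) (s.num 2 0) (s.num 1) (((tryCmd p).run s).nat 2)
          (((tryCmd p).run s).nat 3 0) → ((tryCmd p).run s).nat 1 0 = s.nat 1 0) := by
  obtain ⟨s₁, hs₁⟩ : ∃ s₁, s₁ = (labelCmd p).run s := ⟨_, rfl⟩
  obtain ⟨s₂, hs₂⟩ : ∃ s₂, s₂ = (knapsackCmd 8 7).run s₁ := ⟨_, rfl⟩
  obtain ⟨s₃, hs₃⟩ : ∃ s₃, s₃ = (backtrackCmd (cell (20 + p * p))).run s₂ := ⟨_, rfl⟩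
  obtain ⟨s₄, hs₄⟩ : ∃ s₄, s₄ = s₃.setNat 3 0 (s₃.nat (20 + (p * p + 1)) 0) := ⟨_, rfl⟩
  obtain ⟨s₅, hs₅⟩ : ∃ s₅, s₅ = (knapsackCmd 2 0).run s₄ := ⟨_, rfl⟩
  obtain ⟨s₆, hs₆⟩ : ∃ s₆, s₆ = slackCmd.run s₅ := ⟨_, rfl⟩
  have hrun : (tryCmd p).run s = (ite passTest (.iset 1 (.lit 0) (.lit 1)) .skip).run s₆ := by
    rw [hs₆, hs₅, hs₄, hs₃, hs₂, hs₁]; rfl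
  -- Arrays that survive the individual steps.
  have n1 : ∀ {a}, a ≠ 7 → a ≠ 8 → a ≠ 9 → s₁.nat a = s.nat a := fun h7 h8 h9 => by
    rw [hs₁, run_nat (labelCmd_keeps p h7 h8 h9)]
  have n2 : ∀ {a}, a ≠ 10 → a ≠ 11 → a ≠ 12 → s₂.nat a = s₁.nat a := fun h1 h2 h3 => by
    rw [hs₂, run_nat (knapsackCmd_keeps _ _ h1 h2 h3)]
  have n3 : ∀ {a}, a ≠ 2 → a ≠ 10 → a ≠ 12 → a ≠ 13 → s₃.nat a = s₂.nat a :=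
    fun h1 h2 h3 h4 => by rw [hs₃, run_nat (backtrackCmd_keeps _ h1 h2 h3 h4)]
  have n4 : ∀ {a}, a ≠ 3 → s₄.nat a = s₃.nat a := fun h => by
    rw [hs₄, Store.setNat_nat_of_ne _ _ _ h]
  have n5 : ∀ {a}, a ≠ 10 → a ≠ 11 → a ≠ 12 → s₅.nat a = s₄.nat a := fun h1 h2 h3 => by
    rw [hs₅, run_nat (knapsackCmd_keeps _ _ h1 h2 h3)]
  have n6 : ∀ {a}, a ≠ 10 → a ≠ 11 → s₆.nat a = s₅.nat a := fun h1 h2 => by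
    rw [hs₆, run_nat (slackCmd_keeps h1 h2)]
  have r1 : ∀ {a}, a ≠ 7 → s₁.num a = s.num a := fun h => by
    rw [hs₁, run_num (labelCmd_keepsNum p h)]
  have r2 : ∀ {a}, a ≠ 5 → s₂.num a = s₁.num a := fun h => by
    rw [hs₂, run_num (knapsackCmd_keepsNum _ _ h)]
  have r4 : ∀ {a}, s₄.num a = s₂.num a := by
    rw [hs₄, Store.setNat_num, hs₃]; exact run_num (backtrackCmd_keepsNum _ _) _
  have r5 : ∀ {a}, a ≠ 5 → s₅.num a = s₄.num a := fun h => by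
    rw [hs₅, run_num (knapsackCmd_keepsNum _ _ h)]
  have r6 : ∀ {a}, a ≠ 6 → s₆.num a = s₅.num a := fun h => by
    rw [hs₆, run_num (slackCmd_keepsNum h)]
  have f1 : s₁.nat 4 = s.nat 4 := n1 (by decide) (by decide) (by decide)
  have f2 : s₂.nat 4 = s.nat 4 := (n2 (by decide) (by decide) (by decide)).trans f1
  have f4 : s₄.nat 4 = s.nat 4 :=
    (n4 (by decide)).trans ((n3 (by decide) (by decide) (by decide) (by decide)).trans f2)
  have f5 : s₅.nat 4 = s.nat 4 := (n5 (by decide) (by decide) (by decide)).trans f4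
  have hdigit : ∀ d, s₂.nat (20 + d) = s.nat (20 + d) := fun d =>
    (n2 (by omega) (by omega) (by omega)).trans (n1 (by omega) (by omega) (by omega))
  have hlab := labelCmd_run p s hc
  rw [← hs₁, hn] at hlab
  have hk := knapsackCmd_run (a := 8) (b := 7) (by decide) (by decide) (by decide) (by decide) s₁
  rw [← hs₂, f1, hn] at hk
  have hcand : IsCandidate n c (fun j => c j * s.nat 6 j)
      (fun j => if c j = 0 then 0 else s.num 0 j) (s.nat (20 + p * p) 0) (s₃.nat 2) := by
    have h8 : s₂.nat 8 = s₁.nat 8 := n2 (by decide) (by decide) (by decide)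
    have h7 : s₂.nat 7 = s₁.nat 7 := n2 (by decide) (by decide) (by decide)
    obtain ⟨N, hN, h1, h2, h3⟩ := backtrackCmd_run (s := s₂) (cell (20 + p * p))
      (n := n) (W := s.nat 4 2) (by rw [f2, hn]) (by rw [f2]) hk.1 (v := s₁.num 7)
      (by rw [h8]; exact hk.2) (by rw [cell_val, hdigit]; exact hl)
    rw [← hs₃, h7] at h3
    rw [h8, cell_val, hdigit] at h1 h2
    have hNn : ∀ j ∈ N, j < n := fun j hj => Finset.mem_range.1 (hN hj)
    refine ⟨N, hN, ?_, ?_, fun j hj => ?_⟩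
    · rwa [← Finset.sum_congr rfl fun j hj => (hlab j (hNn j hj)).2.1]
    · rw [← Finset.sum_congr rfl fun j hj => (hlab j (hNn j hj)).2.2, h2]
      exact knapsack_congr (fun j hj => (hlab j hj).2.1) (fun j hj => (hlab j hj).2.2) _
    · rw [h3 j hj, (hlab j hj).1]
  have ha2 : s₄.nat 2 = s₃.nat 2 := n4 (by decide)
  have ha3 : s₄.nat 3 0 = s.nat (20 + (p * p + 1)) 0 := by
    rw [hs₄, Store.setNat_nat, if_pos ⟨rfl, rfl⟩, n3 (by omega) (by omega) (by omega) (by omega),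
      hdigit]
  have g2 : s₆.nat 2 = s₃.nat 2 :=
    (n6 (by decide) (by decide)).trans ((n5 (by decide) (by decide) (by decide)).trans ha2)
  have g3 : s₆.nat 3 0 = s.nat (20 + (p * p + 1)) 0 := by
    rw [n6 (by decide) (by decide), n5 (by decide) (by decide) (by decide), ha3]
  have g1 : s₆.nat 1 = s.nat 1 := by
    rw [n6 (by decide) (by decide), n5 (by decide) (by decide) (by decide), n4 (by decide),
      n3 (by decide) (by decide) (by decide) (by decide), n2 (by decide) (by decide) (by decide),
      n1 (by decide) (by decide) (by decide)]
  have hk2 := knapsackCmd_run (a := 2) (b := 0) (by decide) (by decide) (by decide) (by decide) s₄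
  rw [← hs₅, f4, hn, ha2, r4, r2 (by decide), r1 (by decide)] at hk2
  have hcle : ∀ j < n, s₃.nat 2 j ≤ p := by
    intro j hj
    obtain ⟨N, -, -, -, h⟩ := hcand
    rw [h j hj, hc]
    split
    · exact label_le _ _ _ _
    · omega
  have hsl := slackCmd_run (s := s₅) (n := n) (by rw [f5, hn])
    (by
      intro j hj
      rw [f5, hp, n5 (by decide) (by decide) (by decide), ha2]
      exact (hcle j hj).trans (by omega))
    (by rw [f5, hp, n5 (by decide) (by decide) (by decide), ha3]; exact hb.le)
  rw [← hs₆, n5 (by decide) (by decide) (by decide), n5 (by decide) (by decide) (by decide), ha2,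
    ha3, r5 (by decide), r4, r2 (by decide), r1 (by decide)] at hsl
  have h12 : s₆.nat 12 0 = n * s.nat 4 2 := by rw [n6 (by decide) (by decide), hk2.1]
  have h5 : s₆.num 5 (n * s.nat 4 2 + (s.nat (20 + (p * p + 1)) 0 - 1)) =
      knapsack (s₃.nat 2) (s.num 0) n (s.nat (20 + (p * p + 1)) 0 - 1) := by
    rw [r6 (by decide)]; exact hk2.2 n le_rfl _ (by omega)
  have h2 : s₆.num 2 = s.num 2 := by
    rw [r6 (by decide), r5 (by decide), r4, r2 (by decide), r1 (by decide)]
  have hholds : passTest.holds s₆ ↔ Passes n (s.num 0) (s.num 2 0) (s.num 1) (s₃.nat 2)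
      (s.nat (20 + (p * p + 1)) 0) := by
    simp only [passTest, Test.holds, IExp.val, RExp.val, entry, cell_val, g3, h12, h5, h2, hsl,
      not_le, Nat.cast_zero, sub_neg, Passes]
  by_cases hpass : Passes n (s.num 0) (s.num 2 0) (s.num 1) (s₃.nat 2) (s.nat (20 + (p * p + 1)) 0)
  · have hrun' : (tryCmd p).run s = s₆.setNat 1 0 1 := by
      rw [hrun, run, if_pos (hholds.2 hpass)]; rfl
    rw [hrun', Store.setNat_nat_of_ne _ _ _ (by decide),
      Store.setNat_nat_of_ne _ _ _ (by decide), g2, g3]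
    exact ⟨hcand, rfl, fun _ => by simp, fun h => absurd hpass h⟩
  · have hrun' : (tryCmd p).run s = s₆ := by rw [hrun, run, if_neg (mt hholds.1 hpass)]; rfl
    rw [hrun', g2, g3]
    exact ⟨hcand, rfl, fun h => absurd h hpass, fun _ => by rw [g1]⟩

end Cmd

end RAM

/-! ### Search over all guesses -/

namespace RAM

namespace Cmd

/-- The cell of array `4` that holds the bound for the guess `d`: the first `p * p` guesses are items
or the dummy item `n`, followed by the cost level and the right-hand side. -/
def guessBound (p d : ℕ) : ℕ := if d < p * p then 3 else if d = p * p then 2 else 4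

/-- Runs through all values of the first `m` guesses, until a candidate has passed. -/
def searchCmd (p : ℕ) : ℕ → Cmd
  | 0 => .ite (.ile (cell 1) (.lit 0)) (tryCmd p) .skip
  | m + 1 => .rep (20 + m) (guessBound p m) (searchCmd p m)

theorem searchCmd_keeps {a : ℕ} (p m : ℕ) (ha : a = 0 ∨ a = 4 ∨ a = 5 ∨ a = 6 ∨ 20 + m ≤ a) :
    (searchCmd p m).Keeps a := by
  induction m with
  | zero => exact ⟨tryCmd_keeps p (by omega), trivial⟩
  | succ m ih => exact ⟨by omega, ih (by omega)⟩

theorem searchCmd_keepsNum {a : ℕ} (p m : ℕ) (ha : a ≤ 3) : (searchCmd p m).KeepsNum a := by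
  induction m with
  | zero => exact ⟨tryCmd_keepsNum p ha, trivial⟩
  | succ m ih => exact ih

theorem searchCmd_wf (p m : ℕ) : (searchCmd p m).WF := by
  induction m with
  | zero => exact ⟨tryCmd_wf p, trivial⟩
  | succ m ih => exact ⟨searchCmd_keeps p m (by omega), ih⟩

/-- The flag is down, or the inequality in the output has coefficients up to `p` and passes. -/
def Sound (p n : ℕ) (s : Store) : Prop :=
  s.nat 1 0 = 0 ∨ s.nat 1 0 = 1 ∧ (∀ j < n, s.nat 2 j ≤ p) ∧ s.nat 3 0 ≤ p ∧
    Passes n (s.num 0) (s.num 2 0) (s.num 1) (s.nat 2) (s.nat 3 0)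

/-- Some candidate for the guess `g` does not pass. The guess consists of the guessed items, the
cost level and the right-hand side; weights, point and rounded costs are taken from `s`. -/
def Fails (p n : ℕ) (s : Store) (g : ℕ → ℕ) : Prop :=
  ∃ a, IsCandidate n (label p (s.num 0) g) (fun j => label p (s.num 0) g j * s.nat 6 j)
      (fun j => if label p (s.num 0) g j = 0 then 0 else s.num 0 j) (g (p * p)) a ∧
    ¬ Passes n (s.num 0) (s.num 2 0) (s.num 1) a (g (p * p + 1))

/-- After a search that starts in a sound state, the state is sound, and if the flag is still down,
then all guesses that extend the fixed ones fail. -/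
theorem searchCmd_run {p n m : ℕ} (hm : m ≤ p * p + 2) {s : Store} (hn : s.nat 4 0 = n)
    (hp : s.nat 4 4 = p + 1) (hW : p + 1 ≤ s.nat 4 2)
    (hguess : ∀ d, m ≤ d → d < p * p + 2 → s.nat (20 + d) 0 < s.nat 4 (guessBound p d))
    (hs : Sound p n s) :
    Sound p n ((searchCmd p m).run s) ∧ (((searchCmd p m).run s).nat 1 0 = 0 → s.nat 1 0 = 0 ∧
      ∀ g : ℕ → ℕ, (∀ d < m, g d < s.nat 4 (guessBound p d)) →
        (∀ d, m ≤ d → g d = s.nat (20 + d) 0) → Fails p n s g) := by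
  induction m generalizing s with
  | zero =>
    by_cases h0 : s.nat 1 0 = 0
    · have hrun : (searchCmd p 0).run s = (tryCmd p).run s := by
        simp [searchCmd, run, Test.holds, IExp.val, h0]
      rw [hrun]
      have hl := hguess (p * p) (by omega) (by omega)
      have hb := hguess (p * p + 1) (by omega) (by omega)
      simp only [guessBound, lt_irrefl, if_false, if_true] at hl
      simp only [guessBound, show ¬ p * p + 1 < p * p by omega, show ¬ p * p + 1 = p * p by omega,
        if_false] at hb
      rw [hp] at hb
      obtain ⟨h1, h2, h3, h4⟩ := tryCmd_run hn hp hl hb hW rfl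
      refine ⟨?_, fun hflag => ⟨h0, fun g _ hg => ?_⟩⟩
      · by_cases hpass : Passes n (s.num 0) (s.num 2 0) (s.num 1) (((tryCmd p).run s).nat 2)
          (((tryCmd p).run s).nat 3 0)
        · refine .inr ⟨h3 hpass, fun j hj => ?_, by rw [h2]; omega, ?_⟩
          · obtain ⟨N, -, -, -, h⟩ := h1
            rw [h j hj]
            split
            · exact label_le _ _ _ _
            · omega
          · rwa [run_num (tryCmd_keepsNum p (by decide)), run_num (tryCmd_keepsNum p (by decide)),
              run_num (tryCmd_keepsNum p (by decide))]
        · exact .inl ((h4 hpass).trans h0)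
      · obtain rfl : g = fun d => s.nat (20 + d) 0 := funext fun d => hg d (by omega)
        refine ⟨_, h1, fun hpass => ?_⟩
        have := h3 (by rw [h2]; exact hpass)
        omega
    · have hrun : (searchCmd p 0).run s = s := by
        simp [searchCmd, run, Test.holds, IExp.val, h0]
      rw [hrun]
      exact ⟨hs, fun h => absurd h h0⟩
  | succ m ih =>
    have key := run_rep (v := 20 + m) (k := guessBound p m) (c := searchCmd p m) (s := s)
      (fun i s' => Sound p n s' ∧ (s'.nat 1 0 = 0 → s.nat 1 0 = 0 ∧
        ∀ g : ℕ → ℕ, (∀ d < m, g d < s.nat 4 (guessBound p d)) → g m < i →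
          (∀ d, m + 1 ≤ d → g d = s.nat (20 + d) 0) → Fails p n s g))
      ⟨?_, fun h => ⟨?_, fun g _ h => absurd h (Nat.not_lt_zero _)⟩⟩ ?_
    · refine ⟨key.1, fun h => ⟨(key.2 h).1, fun g hg hg' => (key.2 h).2 g
        (fun d hd => hg d (by omega)) (hg m (by omega)) hg'⟩⟩
    · have e : ∀ a < 20, (s.setNat (20 + m) 0 0).nat a = s.nat a := fun a ha =>
        Store.setNat_nat_of_ne _ _ _ (by omega)
      simpa only [Sound, e 1 (by decide), e 2 (by decide), e 3 (by decide), Store.setNat_num]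
        using hs
    · rwa [Store.setNat_nat_of_ne _ _ _ (by omega)] at h
    · rintro i hi s' ⟨hs', ih'⟩ hcount hnat hnum
      have e4 := hnat 4 (by omega) (searchCmd_keeps p m (by omega))
      have e6 := hnat 6 (by omega) (searchCmd_keeps p m (by omega))
      have ed : ∀ d, m + 1 ≤ d → s'.nat (20 + d) = s.nat (20 + d) := fun d hd =>
        hnat _ (by omega) (searchCmd_keeps p m (by omega))
      have e0 := hnum 0 (searchCmd_keepsNum p m (by decide))
      have e1 := hnum 1 (searchCmd_keepsNum p m (by decide))
      have e2 := hnum 2 (searchCmd_keepsNum p m (by decide))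
      have h := ih (by omega) (s := s') (by rw [e4, hn]) (by rw [e4, hp]) (by rw [e4]; exact hW)
        (fun d hd hd' => by
          rcases hd.eq_or_lt with rfl | hd
          · rw [hcount, e4]; exact hi
          · rw [ed d hd, e4]; exact hguess d hd hd') hs'
      have e : ∀ a < 20, (((searchCmd p m).run s').setNat (20 + m) 0 (i + 1)).nat a =
        ((searchCmd p m).run s').nat a := fun a ha => Store.setNat_nat_of_ne _ _ _ (by omega)
      simp only [Sound, Fails, e 1 (by decide), e 2 (by decide), e 3 (by decide), Store.setNat_num]
      refine ⟨h.1, fun h0 => ?_⟩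
      obtain ⟨h0', hf⟩ := h.2 h0
      refine ⟨(ih' h0').1, fun g hg hgm hg' => ?_⟩
      by_cases hgi : g m < i
      · exact (ih' h0').2 g hg hgi hg'
      · have := hf g (by rw [e4]; exact hg) (fun d hd => by
          rcases hd.eq_or_lt with rfl | hd
          · rw [hcount]; omega
          · rw [ed d hd]; exact hg' d hd)
        simpa only [Fails, e0, e1, e2, e6] using this

/-! ### Rounding the costs -/

/-- Computes the rounded cost of item `9[0]`: after `n * p * x` has been accumulated, `ε` is
subtracted from it as often as possible. -/
def roundItemCmd (p : ℕ) : Cmd :=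
  .seq (.rset 4 (.lit 0) (.lit 0))
    (.seq (.rep 10 0 (.rset 4 (.lit 0) (.add (.get 4 (.lit 0)) (.nsmul p (.get 1 (cell 9))))))
      (.rep 11 2 (.ite (.rle (.get 3 (.lit 0)) (.get 4 (.lit 0)))
        (.seq (.rset 4 (.lit 0) (.sub (.get 4 (.lit 0)) (.get 3 (.lit 0))))
          (.iset 6 (cell 9) (.add (.get 6 (cell 9)) (.lit 1)))) .skip)))

/-- Computes all rounded costs. -/
def roundCmd (p : ℕ) : Cmd := .rep 9 0 (roundItemCmd p)

theorem roundCmd_keeps {a : ℕ} (p : ℕ) (h6 : a ≠ 6) (h9 : a ≠ 9) (h10 : a ≠ 10) (h11 : a ≠ 11) :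
    (roundCmd p).Keeps a := by
  simp [roundCmd, roundItemCmd, Keeps, h6, h9, h10, h11]

theorem roundCmd_keepsNum {a : ℕ} (p : ℕ) (h4 : a ≠ 4) : (roundCmd p).KeepsNum a := by
  simp [roundCmd, roundItemCmd, KeepsNum, h4]

theorem roundCmd_wf (p : ℕ) : (roundCmd p).WF := by
  simp [roundCmd, roundItemCmd, WF, Keeps]

theorem roundItemCmd_run {p n j : ℕ} {s : Store} {ε y : ℝ} (hn : s.nat 4 0 = n)
    (hj : s.nat 9 0 = j) (hε : s.num 3 0 = ε) (hy : n * p * s.num 1 j = y) (hy0 : 0 ≤ y)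
    (hq : s.nat 6 j = 0) (hyW : y < s.nat 4 2 * ε) :
    (((roundItemCmd p).run s).nat 6 j * ε ≤ y ∧ y ≤ (((roundItemCmd p).run s).nat 6 j + 1) * ε) ∧
      ∀ i ≠ j, ((roundItemCmd p).run s).nat 6 i = s.nat 6 i := by
  obtain ⟨s₁, hs₁⟩ : ∃ s₁, s₁ = (rep 10 0 (.rset 4 (.lit 0) (.add (.get 4 (.lit 0))
    (.nsmul p (.get 1 (cell 9)))))).run (s.setNum 4 0 0) := ⟨_, rfl⟩
  have n1 : ∀ a, a ≠ 10 → s₁.nat a = s.nat a := fun a ha => by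
    rw [hs₁, run_nat (by simp [Keeps, ha])]; rfl
  have r1 : ∀ a, a ≠ 4 → s₁.num a = s.num a := fun a ha => by
    rw [hs₁, run_num (by simp [KeepsNum, ha]), Store.setNum_num_of_ne _ _ _ ha]
  have hs₁y : s₁.num 4 0 = y := by
    have key := run_rep (v := 10) (k := 0) (s := s.setNum 4 0 0)
      (c := .rset 4 (.lit 0) (.add (.get 4 (.lit 0)) (.nsmul p (.get 1 (cell 9)))))
      (fun i s' => s'.num 4 0 = i * p * s.num 1 j) (by simp) ?_
    · rw [← hs₁, Store.setNum_nat, hn] at key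
      rw [key, hy]
    · intro i _ s' ih _ hnat hnum
      have e9 : s'.nat 9 = s.nat 9 := hnat 9 (by decide) (by simp [Keeps])
      have e1 : s'.num 1 = s.num 1 := hnum 1 (by simp [KeepsNum])
      simp only [run, RExp.val, IExp.val, cell_val, RExp.nsmul_val, Store.setNat_num,
        Store.setNum_num, e9, e1, hj, ih, and_self, if_true]
      push_cast; ring
  have hrun : (roundItemCmd p).run s = (rep 11 2 (.ite (.rle (.get 3 (.lit 0)) (.get 4 (.lit 0)))
        (.seq (.rset 4 (.lit 0) (.sub (.get 4 (.lit 0)) (.get 3 (.lit 0))))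
          (.iset 6 (cell 9) (.add (.get 6 (cell 9)) (.lit 1)))) .skip)).run s₁ := by
    rw [hs₁]; simp [roundItemCmd, run, IExp.val, RExp.val]
  rw [hrun]
  -- The remainder stays nonnegative, and it is below `ε` unless every round so far subtracted.
  have key := run_rep (v := 11) (k := 2) (s := s₁)
    (c := .ite (.rle (.get 3 (.lit 0)) (.get 4 (.lit 0)))
        (.seq (.rset 4 (.lit 0) (.sub (.get 4 (.lit 0)) (.get 3 (.lit 0))))
          (.iset 6 (cell 9) (.add (.get 6 (cell 9)) (.lit 1)))) .skip)
    (fun i s' => s'.num 4 0 + s'.nat 6 j * ε = y ∧ 0 ≤ s'.num 4 0 ∧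
      (s'.num 4 0 < ε ∨ s'.nat 6 j = i) ∧ ∀ i ≠ j, s'.nat 6 i = s.nat 6 i) ?_ ?_
  · obtain ⟨h1, h2, h3, h4⟩ := key
    refine ⟨⟨by linarith, ?_⟩, h4⟩
    rcases h3 with h3 | h3
    · linarith
    · rw [h3, n1 4 (by decide)] at h1
      linarith
  · have e6 := n1 6 (by decide)
    simp only [Store.setNat_num, Store.setNat_nat, show (6 : ℕ) ≠ 11 by decide, false_and, if_false,
      hs₁y, e6, hq]
    simp [hy0]
  · rintro i _ s' ⟨h1, h2, h3, h4⟩ _ hnat hnum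
    have e9 : s'.nat 9 0 = j := by rw [hnat 9 (by decide) (by simp [Keeps]), n1 9 (by decide), hj]
    have e3 : s'.num 3 0 = ε := by rw [hnum 3 (by simp [KeepsNum]), r1 3 (by decide), hε]
    by_cases hle : ε ≤ s'.num 4 0
    · have h5 : s'.nat 6 j = i := h3.resolve_left (not_lt.2 hle)
      simp only [run, Test.holds, RExp.val, IExp.val, cell_val, e3, if_pos hle, Store.setNum_nat,
        Store.setNat_num, Store.setNat_nat, Store.setNum_num, e9, true_and, and_self, if_true,
        show (6 : ℕ) ≠ 11 by decide, false_and, if_false]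
      refine ⟨?_, by linarith, .inr (by rw [h5]), fun i hi => ?_⟩
      · push_cast; linarith
      · rw [if_neg hi]; exact h4 i hi
    · simp only [run, Test.holds, RExp.val, IExp.val, e3, if_neg hle,
        Store.setNat_num, Store.setNat_nat, show (6 : ℕ) ≠ 11 by decide, false_and, if_false]
      exact ⟨h1, h2, .inl (not_le.1 hle), h4⟩

theorem roundCmd_run {p n : ℕ} {s : Store} {ε : ℝ} (hn : s.nat 4 0 = n) (hε : s.num 3 0 = ε)
    (hx0 : ∀ j, 0 ≤ s.num 1 j) (hq : ∀ j, s.nat 6 j = 0)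
    (hW : ∀ j < n, n * p * s.num 1 j < s.nat 4 2 * ε) :
    ∀ j < n, ((roundCmd p).run s).nat 6 j * ε ≤ n * p * s.num 1 j ∧
      n * p * s.num 1 j ≤ (((roundCmd p).run s).nat 6 j + 1) * ε := by
  have key := run_rep (v := 9) (k := 0) (c := roundItemCmd p) (s := s)
    (fun i s' => (∀ j < i, s'.nat 6 j * ε ≤ n * p * s.num 1 j ∧
      n * p * s.num 1 j ≤ (s'.nat 6 j + 1) * ε) ∧ ∀ j, i ≤ j → s'.nat 6 j = 0)
    ⟨by simp, fun j _ => by simpa using hq j⟩ ?_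
  · intro j hj
    rw [hn] at key
    exact key.1 j hj
  · rintro i hi s' ⟨h1, h2⟩ h9 hnat hnum
    have e4 := hnat 4 (by decide) (by simp [roundItemCmd, Keeps])
    have e1 := hnum 1 (by simp [roundItemCmd, KeepsNum])
    have e3 := hnum 3 (by simp [roundItemCmd, KeepsNum])
    rw [hn] at hi
    have hstep := roundItemCmd_run (p := p) (n := n) (s := s') (ε := ε) (by rw [e4, hn]) h9
      (by rw [e3]; exact hε) rfl
      (by rw [e1]; have := hx0 i; positivity) (h2 i le_rfl) (by rw [e1, e4]; exact hW i hi)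
    rw [e1] at hstep
    simp only [Store.setNat_nat, show (6 : ℕ) ≠ 9 by decide, false_and, if_false]
    refine ⟨fun j hj => ?_, fun j hj => ?_⟩
    · rcases Nat.lt_succ_iff_lt_or_eq.1 hj with hj | rfl
      · rw [hstep.2 j hj.ne]; exact h1 j hj
      · exact hstep.1
    · rw [hstep.2 j (by omega)]; exact h2 j (by omega)

/-! ### The number of cost levels -/

/-- Adds `n * n * K * p ^ 2` to `5[0]`; no guess needs a higher cost level. -/
def levelsCmd (p : ℕ) : Cmd :=
  .rep 9 0 (.rep 10 0 (.rep 11 1 (.iset 5 (.lit 0) (.add (cell 5) (.lit (p * p))))))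

theorem levelsCmd_keeps {a : ℕ} (p : ℕ) (h5 : a ≠ 5) (h9 : a ≠ 9) (h10 : a ≠ 10) (h11 : a ≠ 11) :
    (levelsCmd p).Keeps a := by
  simp [levelsCmd, Keeps, h5, h9, h10, h11]

theorem levelsCmd_keepsNum (a p : ℕ) : (levelsCmd p).KeepsNum a := by
  simp [levelsCmd, KeepsNum]

theorem levelsCmd_wf (p : ℕ) : (levelsCmd p).WF := by simp [levelsCmd, WF, Keeps]

/-- A loop whose body adds `D` to `5[0]` adds `D` times the number of its rounds. -/
theorem rep_run_add {v k D : ℕ} {c : Cmd} (hv : 5 ≠ v) (hv4 : 4 ≠ v) (h4 : c.Keeps 4) {s : Store}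
    (hc : ∀ s' : Store, s'.nat 4 = s.nat 4 → (c.run s').nat 5 0 = s'.nat 5 0 + D) :
    ((rep v k c).run s).nat 5 0 = s.nat 5 0 + s.nat 4 k * D := by
  refine run_rep (fun i s' => s'.nat 5 0 = s.nat 5 0 + i * D)
    (by simp [hv]) ?_
  intro i _ s' ih _ hnat _
  rw [Store.setNat_nat_of_ne _ _ _ hv, hc s' (hnat 4 hv4 h4), ih]
  ring

theorem levelsCmd_run (p : ℕ) (s : Store) : ((levelsCmd p).run s).nat 5 0 =
    s.nat 5 0 + s.nat 4 0 * (s.nat 4 0 * (s.nat 4 1 * (p * p))) := by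
  refine rep_run_add (by decide) (by decide) (by simp [Keeps]) fun s₁ h₁ => ?_
  rw [← h₁]
  refine rep_run_add (by decide) (by decide) (by simp [Keeps]) fun s₂ h₂ => ?_
  rw [← h₂]
  refine rep_run_add (by decide) (by decide) (by simp [Keeps]) fun s₃ _ => ?_
  simp [run, IExp.val]

end Cmd

/-! ### Bounding the inverse of the tolerance -/

/-- Counts in `4[1]` how often `ε` has to be added up to reach `1`. -/
def invProgram : Program :=
  .loop (.not (.rle (.lit 1) (.get 4 (.lit 0))))
    (.seq (.rset 4 (.lit 0) (.add (.get 4 (.lit 0)) (.get 3 (.lit 0))))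
      (.iset 4 (.lit 1) (.add (.get 4 (.lit 1)) (.lit 1))))

theorem invProgram_exec {s : Store} {ε : ℝ} (hε : 0 < ε) (h3 : s.num 3 0 = ε) {i r : ℕ}
    (hi : s.nat 4 1 = i) (h4 : s.num 4 0 = i * ε) (hr : i + r = ⌈1 / ε⌉₊) :
    ∃ s' t, Exec invProgram s s' t ∧ t ≤ 30 * r + 30 ∧ s'.nat 4 1 = ⌈1 / ε⌉₊ ∧
      (∀ j ≠ 1, s'.nat 4 j = s.nat 4 j) ∧ (∀ a ≠ 4, s'.nat a = s.nat a) ∧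
      ∀ a ≠ 4, s'.num a = s.num a := by
  have htest : (Test.not (.rle (.lit 1) (.get 4 (.lit 0)))).holds s ↔ i < ⌈1 / ε⌉₊ := by
    simp only [Test.holds, RExp.val, IExp.val, h4, Nat.cast_one, not_le, Nat.lt_ceil,
      lt_div_iff₀ hε]
  induction r generalizing s i with
  | zero =>
    refine ⟨s, _, .loop_done _ (by rw [htest]; omega), ?_, by omega, fun _ _ => rfl,
      fun _ _ => rfl, fun _ _ => rfl⟩
    simp [Test.cost, RExp.cost, IExp.cost]
  | succ r ih =>
    obtain ⟨s₁, hs₁⟩ : ∃ s₁, s₁ = (s.setNum 4 0 (i * ε + ε)).setNat 4 1 (i + 1) := ⟨_, rfl⟩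
    have h3' : s₁.num 3 0 = ε := by simpa [hs₁] using h3
    have hi' : s₁.nat 4 1 = i + 1 := by simp [hs₁]
    have h4' : s₁.num 4 0 = (i + 1 : ℕ) * ε := by simp [hs₁]; ring
    obtain ⟨s', t, h, ht, k1, k2, k3, k4⟩ := ih h3' hi' h4' (by omega) (by
      simp only [Test.holds, RExp.val, IExp.val, h4', Nat.cast_one, not_le, Nat.lt_ceil,
        lt_div_iff₀ hε])
    have hbody : Exec (.seq (.rset 4 (.lit 0) (.add (.get 4 (.lit 0)) (.get 3 (.lit 0))))
        (.iset 4 (.lit 1) (.add (.get 4 (.lit 1)) (.lit 1)))) s s₁ 13 := by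
      have := Exec.seq (.rset 4 (.lit 0) (.add (.get 4 (.lit 0)) (.get 3 (.lit 0))) s)
        (.iset 4 (.lit 1) (.add (.get 4 (.lit 1)) (.lit 1)) _)
      simpa [IExp.val, RExp.val, IExp.cost, RExp.cost, h4, h3, hi, ← hs₁] using this
    refine ⟨s', _, .loop_step (by rw [htest]; omega) hbody h, ?_, k1, fun j hj => ?_, fun a ha => ?_,
      fun a ha => ?_⟩
    · simp only [Test.cost, RExp.cost, IExp.cost]; omega
    · rw [k2 j hj, hs₁]; simp [hj]
    · rw [k3 a ha, hs₁, Store.setNat_nat_of_ne _ _ _ ha]; rfl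
    · rw [k4 a ha, hs₁, Store.setNat_num, Store.setNum_num_of_ne _ _ _ ha]

/-! ### The separation algorithm -/

/-- The command that does the actual work once the loop bounds are known. -/
def mainCmd (p : ℕ) : Cmd := .seq (.roundCmd p) (.searchCmd p (p * p + 2))

/-- The separation algorithm. -/
def sepProgram (p : ℕ) : Program :=
  .seq (.iset 4 (.lit 0) (cell 0)) (.seq invProgram (.seq (Cmd.levelsCmd p).compile
    (.seq (.iset 4 (.lit 2) (.add (cell 5) (.lit (p + 1))))
      (.seq (.iset 4 (.lit 3) (.add (cell 0) (.lit 1)))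
        (.seq (.iset 4 (.lit 4) (.lit (p + 1))) (mainCmd p).compile)))))

/-- The working state of the main command: the input is in place and the loop bounds are set. -/
structure Ready (p n : ℕ) (w x : ℕ → ℝ) (w₀ ε : ℝ) (s : Store) : Prop where
  items : s.nat 4 0 = n
  levels : s.nat 4 2 = n * (n * (⌈1 / ε⌉₊ * (p * p))) + (p + 1)
  choices : s.nat 4 3 = n + 1
  coeffs : s.nat 4 4 = p + 1
  zero : ∀ a, a ≠ 0 → a ≠ 4 → a ≠ 5 → a ≠ 9 → a ≠ 10 → a ≠ 11 → ∀ i, s.nat a i = 0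
  weights : s.num 0 = w
  point : s.num 1 = x
  demand : s.num 2 0 = w₀
  tolerance : s.num 3 0 = ε

/-- The program reaches a working state and then runs the main command, within a time bound that is
polynomial in `n` and in `1 / ε` rounded up. -/
theorem sepProgram_exec {p n : ℕ} (w : Fin n → ℕ) (w₀ : ℕ) {ε : ℝ} (x : Fin n → ℝ) (hε : 0 < ε) :
    ∃ s t, Ready p n (arrayOf fun j => (w j : ℝ)) (arrayOf x) w₀ ε s ∧
      Exec (sepProgram p) (sepInput w w₀ ε x) ((mainCmd p).run s) t ∧
      t ≤ 30 * ⌈1 / ε⌉₊ + 60 + ((Cmd.levelsCmd p).time + (mainCmd p).time).eval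
        (n + ⌈1 / ε⌉₊ + n * (n * (⌈1 / ε⌉₊ * (p * p))) + (p + 1)) := by
  set K := ⌈1 / ε⌉₊ with hK
  set M := n + K + n * (n * (K * (p * p))) + (p + 1) with hM
  obtain ⟨s₀, hs₀⟩ : ∃ s₀, s₀ = sepInput w w₀ ε x := ⟨_, rfl⟩
  have h00 : s₀.nat 0 0 = n := by simp [hs₀, sepInput]
  have hz : ∀ a i, a ≠ 0 → s₀.nat a i = 0 := by
    intro a i ha; simp [hs₀, sepInput, ha]
  obtain ⟨s₁, hs₁⟩ : ∃ s₁, s₁ = s₀.setNat 4 0 n := ⟨_, rfl⟩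
  have n1 : ∀ a ≠ 4, s₁.nat a = s₀.nat a := fun a ha => by
    rw [hs₁, Store.setNat_nat_of_ne _ _ _ ha]
  have r1 : s₁.num = s₀.num := by rw [hs₁]; rfl
  have h1 : Exec (.iset 4 (.lit 0) (cell 0)) s₀ s₁ 4 := by
    have := Exec.iset 4 (.lit 0) (cell 0) s₀
    rw [cell_val, h00] at this
    rw [hs₁]; exact this
  obtain ⟨s₂, t₂, h2, ht2, k1, k2, n2, r2⟩ := invProgram_exec (s := s₁) hε (i := 0) (r := K)
    (by rw [r1, hs₀]; simp [sepInput]) (by simp [hs₁, hz]) (by rw [r1, hs₀]; simp [sepInput])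
    (by rw [zero_add])
  have h2M : ∀ i, s₂.nat 4 i ≤ M := by
    intro i
    by_cases h1 : i = 1
    · rw [h1, k1]; omega
    · rw [k2 i h1, hs₁]
      by_cases h0 : i = 0
      · simp [h0]; omega
      · simp [h0, hz]
  obtain ⟨t₃, ht3, h3⟩ := Cmd.exec_compile (Cmd.levelsCmd_wf p)
    (Cmd.levelsCmd_keeps p (by decide) (by decide) (by decide) (by decide)) h2M
  obtain ⟨s₃, hs₃⟩ : ∃ s₃, s₃ = (Cmd.levelsCmd p).run s₂ := ⟨_, rfl⟩
  rw [← hs₃] at h3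
  have n3 : ∀ a, a ≠ 5 → a ≠ 9 → a ≠ 10 → a ≠ 11 → s₃.nat a = s₂.nat a :=
    fun a h5 h9 h10 h11 => by rw [hs₃, Cmd.run_nat (Cmd.levelsCmd_keeps p h5 h9 h10 h11)]
  have r3 : ∀ a, s₃.num a = s₂.num a := fun a => by
    rw [hs₃, Cmd.run_num (Cmd.levelsCmd_keepsNum a p)]
  have e2n : s₂.nat 4 0 = n := by rw [k2 0 (by decide), hs₁]; simp
  have hL : s₃.nat 5 0 = n * (n * (K * (p * p))) := by
    rw [hs₃, Cmd.levelsCmd_run, e2n, k1, n2 5 (by decide), n1 5 (by decide), hz 5 0 (by decide),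
      zero_add]
  have h30 : s₃.nat 0 0 = n := by
    rw [n3 0 (by decide) (by decide) (by decide) (by decide), n2 0 (by decide), n1 0 (by decide),
      h00]
  have h34 : s₃.nat 4 = s₂.nat 4 := n3 4 (by decide) (by decide) (by decide) (by decide)
  obtain ⟨s₆, hs₆⟩ : ∃ s₆, s₆ = ((s₃.setNat 4 2 (n * (n * (K * (p * p))) + (p + 1))).setNat 4 3
    (n + 1)).setNat 4 4 (p + 1) := ⟨_, rfl⟩
  have n6 : ∀ a ≠ 4, s₆.nat a = s₃.nat a := fun a ha => by
    rw [hs₆, Store.setNat_nat_of_ne _ _ _ ha, Store.setNat_nat_of_ne _ _ _ ha,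
      Store.setNat_nat_of_ne _ _ _ ha]
  have r6 : ∀ a ≠ 4, s₆.num a = s₀.num a := fun a ha => by
    have : s₆.num a = s₃.num a := by rw [hs₆]; rfl
    rw [this, r3, r2 a ha, r1]
  have h6M : ∀ i, s₆.nat 4 i ≤ M := by
    intro i
    have := h2M i
    rw [← h34] at this
    simp only [hs₆, Store.setNat_nat, true_and]
    split_ifs <;> omega
  have hmain : (mainCmd p).Keeps 4 :=
    ⟨Cmd.roundCmd_keeps p (by decide) (by decide) (by decide) (by decide),
      Cmd.searchCmd_keeps p _ (by omega)⟩
  obtain ⟨t₇, ht7, h7⟩ := Cmd.exec_compile (c := mainCmd p)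
    ⟨Cmd.roundCmd_wf p, Cmd.searchCmd_wf p _⟩ hmain h6M
  have h4 : Exec (.iset 4 (.lit 2) (.add (cell 5) (.lit (p + 1)))) s₃
      (s₃.setNat 4 2 (n * (n * (K * (p * p))) + (p + 1))) 6 := by
    have := Exec.iset 4 (.lit 2) (.add (cell 5) (.lit (p + 1))) s₃
    simpa only [IExp.val, cell_val, hL] using! this
  have h5 : Exec (.iset 4 (.lit 3) (.add (cell 0) (.lit 1)))
      (s₃.setNat 4 2 (n * (n * (K * (p * p))) + (p + 1)))
      ((s₃.setNat 4 2 (n * (n * (K * (p * p))) + (p + 1))).setNat 4 3 (n + 1)) 6 := by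
    have := Exec.iset 4 (.lit 3) (.add (cell 0) (.lit 1))
      (s₃.setNat 4 2 (n * (n * (K * (p * p))) + (p + 1)))
    simpa only [IExp.val, cell_val, Store.setNat_nat_of_ne _ _ _ (show 0 ≠ 4 by decide), h30]
      using! this
  have h6 : Exec (.iset 4 (.lit 4) (.lit (p + 1)))
      ((s₃.setNat 4 2 (n * (n * (K * (p * p))) + (p + 1))).setNat 4 3 (n + 1)) s₆ 3 := by
    rw [hs₆]; exact Exec.iset 4 (.lit 4) (.lit (p + 1)) _
  have hexec : Exec (sepProgram p) s₀ ((mainCmd p).run s₆)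
      (4 + (t₂ + (t₃ + (6 + (6 + (3 + t₇)))))) :=
    .seq h1 (.seq h2 (.seq h3 (.seq h4 (.seq h5 (.seq h6 h7)))))
  refine ⟨s₆, _, ?_, hs₀ ▸ hexec, ?_⟩
  · refine ⟨?_, ?_, ?_, ?_, fun a g0 g4 g5 g9 g10 g11 i => ?_, ?_, ?_, ?_, ?_⟩
    · rw [hs₆]; simp [h34, e2n]
    · rw [hs₆]; simp [hK]
    · rw [hs₆]; simp
    · rw [hs₆]; simp
    · rw [n6 a g4, n3 a g5 g9 g10 g11, n2 a g4, n1 a g4, hz a i g0]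
    · rw [r6 0 (by decide), hs₀]; rfl
    · rw [r6 1 (by decide), hs₀]; rfl
    · rw [r6 2 (by decide), hs₀]; simp [sepInput]
    · rw [r6 3 (by decide), hs₀]; simp [sepInput]
  · rw [Polynomial.eval_add]; omega

/-- From a working state, the main command answers correctly. -/
theorem Ready.mainCmd_run {p n : ℕ} {w x : ℕ → ℝ} {w₀ ε : ℝ} {s : Store} (hp : 1 ≤ p)
    (hs : Ready p n w x w₀ ε s) (hε : 0 < ε) (hx0 : ∀ j, 0 ≤ x j) (hx1 : ∀ j, x j ≤ 1)
    (hw : ∀ j, 0 ≤ w j) (hwn : w n = 0) :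
    (((mainCmd p).run s).nat 1 0 = 1 ∧ (∀ j < n, ((mainCmd p).run s).nat 2 j ≤ p) ∧
      ((mainCmd p).run s).nat 3 0 ≤ p ∧
      Passes n w w₀ x (((mainCmd p).run s).nat 2) (((mainCmd p).run s).nat 3 0)) ∨
    (((mainCmd p).run s).nat 1 0 = 0 ∧ ∀ (α : ℕ → ℕ) (b : ℕ), (∀ j, α j ≤ p) → 1 ≤ b → b ≤ p →
      (∀ S ⊆ Finset.range n, ∑ j ∈ S, α j ≤ b - 1 → ∑ j ∈ S, w j < w₀) →
      b - ε ≤ ∑ j ∈ Finset.range n, (α j : ℝ) * x j) := by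
  set K := ⌈1 / ε⌉₊ with hK
  have hKε : 1 ≤ K * ε := (div_le_iff₀ hε).1 (Nat.le_ceil _)
  have hlev := hs.levels
  rw [← hK] at hlev
  have hround := Cmd.roundCmd_run (p := p) (s := s) hs.items hs.tolerance
    (by rw [hs.point]; exact hx0)
    (hs.zero 6 (by decide) (by decide) (by decide) (by decide) (by decide) (by decide))
    (by
      intro j hj
      rw [hs.point, hlev]
      have h1 : (n * p : ℝ) * x j ≤ n * p := by
        have : (0 : ℝ) ≤ n * p := by positivity
        nlinarith [hx1 j]
      have h2 : (n * p : ℝ) ≤ n * p * (K * ε) :=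
        le_mul_of_one_le_right (by positivity) hKε
      have h3 : n * p * K ≤ n * (n * (K * (p * p))) := by
        have : n * p * K * 1 ≤ n * p * K * (n * p) :=
          Nat.mul_le_mul_left _ (Nat.mul_pos (by omega) (by omega))
        calc n * p * K = n * p * K * 1 := by ring
          _ ≤ n * p * K * (n * p) := this
          _ = _ := by ring
      have h4 : ((n * p * K : ℕ) : ℝ) < (n * (n * (K * (p * p))) + (p + 1) : ℕ) := by
        exact_mod_cast (by omega : n * p * K < n * (n * (K * (p * p))) + (p + 1))
      have h5 := mul_lt_mul_of_pos_right h4 hε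
      push_cast at h5 ⊢
      nlinarith)
  obtain ⟨s₁, hs₁⟩ : ∃ s₁, s₁ = (Cmd.roundCmd p).run s := ⟨_, rfl⟩
  have hrun : (mainCmd p).run s = (Cmd.searchCmd p (p * p + 2)).run s₁ := by rw [hs₁]; rfl
  have n1 : ∀ a, a ≠ 6 → a ≠ 9 → a ≠ 10 → a ≠ 11 → s₁.nat a = s.nat a := fun a h1 h2 h3 h4 => by
    rw [hs₁, Cmd.run_nat (Cmd.roundCmd_keeps p h1 h2 h3 h4)]
  have r1 : ∀ a, a ≠ 4 → s₁.num a = s.num a := fun a h => by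
    rw [hs₁, Cmd.run_num (Cmd.roundCmd_keepsNum p h)]
  have e4 : s₁.nat 4 = s.nat 4 := n1 4 (by decide) (by decide) (by decide) (by decide)
  have ew : s₁.num 0 = w := (r1 0 (by decide)).trans hs.weights
  have ex : s₁.num 1 = x := (r1 1 (by decide)).trans hs.point
  have ew₀ : s₁.num 2 0 = w₀ := by rw [r1 2 (by decide)]; exact hs.demand
  rw [← hs₁, hs.point] at hround
  have h1 : s₁.nat 1 0 = 0 := by
    rw [n1 1 (by decide) (by decide) (by decide) (by decide)]
    exact hs.zero 1 (by decide) (by decide) (by decide) (by decide) (by decide) (by decide) 0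
  obtain ⟨hsound, hfail⟩ := Cmd.searchCmd_run (p := p) (n := n) (m := p * p + 2) le_rfl (s := s₁)
    (by rw [e4, hs.items]) (by rw [e4, hs.coeffs]) (by rw [e4, hlev]; omega)
    (fun d h1 h2 => by omega) (.inl h1)
  rw [← hrun] at hsound hfail
  have rm : ∀ a ≤ 3, ((mainCmd p).run s).num a = s₁.num a := fun a ha => by
    rw [hrun, Cmd.run_num (Cmd.searchCmd_keepsNum p _ ha)]
  rcases hsound with h0 | ⟨h0, hc, hb, hpass⟩
  · refine .inr ⟨h0, fun α b hα hb1 hb hvalid => ?_⟩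
    by_contra! hviol
    obtain ⟨g, l, hg, hl, hgood⟩ := exists_passing_guess hp hε hw hwn hx0 hx1 hKε
      (fun j hj => (hround j hj).1) (fun j hj => (hround j hj).2) hα hb1 hb hvalid hviol
    obtain ⟨g', hg'⟩ : ∃ g' : ℕ → ℕ, g' = fun d => if d < p * p then g d else if d = p * p then l
        else if d = p * p + 1 then b else s₁.nat (20 + d) 0 := ⟨_, rfl⟩
    have hlab : label p w g' = label p w g := funext fun j => label_congr fun d hd => by
      simp only [hg', if_pos hd]
    have hgl : g' (p * p) = l := by simp [hg']
    have hgb : g' (p * p + 1) = b := by simp [hg']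
    obtain ⟨a, ha, hna⟩ := (hfail h0).2 g'
      (fun d hd => by
        rw [e4]
        by_cases h1 : d < p * p
        · have := hg d
          simp only [hg', Cmd.guessBound, if_pos h1, hs.choices]
          omega
        · by_cases h2 : d = p * p
          · subst h2
            have : n * n * K * (p * p) = n * (n * (K * (p * p))) := by ring
            simp only [hgl, Cmd.guessBound, lt_irrefl, if_false, if_true, hlev]
            omega
          · obtain rfl : d = p * p + 1 := by omega
            simp only [hgb, Cmd.guessBound, if_neg h1, if_neg h2, hs.coeffs]
            omega)
      (fun d hd => by
        simp only [hg', show ¬ d < p * p by omega, show ¬ d = p * p by omega,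
          show ¬ d = p * p + 1 by omega, if_false])
    rw [ew, ex, ew₀, hgb] at hna
    rw [ew, hlab, hgl] at ha
    exact hna (hgood a ha)
  · refine .inl ⟨h0, hc, hb, ?_⟩
    rwa [rm 0 (by decide), rm 1 (by decide), rm 2 (by decide), ew, ex, ew₀] at hpass

end RAM

/-! ### Sets of items and points of the minimum-knapsack set -/

@[simp] theorem arrayOf_val {n : ℕ} (v : Fin n → ℝ) (j : Fin n) : arrayOf v j = v j := by
  simp [arrayOf]

theorem sum_mul_indicator {n : ℕ} {S : Finset ℕ} (hS : S ⊆ Finset.range n) (f : ℕ → ℝ) :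
    ∑ j : Fin n, f j * (if (j : ℕ) ∈ S then 1 else 0) = ∑ j ∈ S, f j := by
  rw [← Finset.sum_range fun j => f j * (if j ∈ S then 1 else 0)]
  simp only [mul_ite, mul_one, mul_zero]
  rw [← Finset.sum_filter, Finset.filter_mem_eq_inter, Finset.inter_eq_right.2 hS]

/-- The knapsack recursion certifies validity: its value bounds the weight of every set of items
that violates the inequality. -/
theorem isValidIneq_of_knapsack_lt {n b : ℕ} {w : Fin n → ℕ} {w₀ : ℕ} {a : ℕ → ℕ}
    (h : knapsack a (arrayOf fun j => (w j : ℝ)) n (b - 1) < w₀) :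
    IsValidIneq (minKnapsack w w₀) (fun j => a j) b := by
  rintro x ⟨hx, hxw⟩
  obtain ⟨S, hS⟩ : ∃ S, S = (Finset.range n).filter fun i => arrayOf x i = 1 := ⟨_, rfl⟩
  have hSn : S ⊆ Finset.range n := hS ▸ Finset.filter_subset _ _
  have hxS : ∀ j : Fin n, x j = if (j : ℕ) ∈ S then 1 else 0 := fun j => by
    rcases hx j with h | h <;> simp [hS, h]
  have hw := sum_mul_indicator hSn (arrayOf fun j => (w j : ℝ))
  have ha := sum_mul_indicator hSn (fun j => (a j : ℝ))
  simp only [arrayOf_val, ← hxS] at hw ha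
  rw [hw] at hxw
  rw [ha]
  by_contra! hlt
  have hlt' : ∑ j ∈ S, a j < b := by exact_mod_cast hlt
  have := le_knapsack (v := arrayOf fun j => (w j : ℝ)) hSn (l := b - 1) (c := a) (by omega)
  linarith

/-- Validity for the minimum-knapsack set in terms of sets of items. -/
theorem IsValidIneq.sum_lt {n b : ℕ} {w : Fin n → ℕ} {w₀ : ℕ} {α : Fin n → ℕ} {a : ℕ → ℕ}
    (h : IsValidIneq (minKnapsack w w₀) α b) (hb : 1 ≤ b) (ha : ∀ j : Fin n, a j = α j)
    {S : Finset ℕ} (hS : S ⊆ Finset.range n) (hSb : ∑ j ∈ S, a j ≤ b - 1) :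
    ∑ j ∈ S, arrayOf (fun j => (w j : ℝ)) j < w₀ := by
  by_contra! hle
  have hw := sum_mul_indicator hS (arrayOf fun j => (w j : ℝ))
  have ha' := sum_mul_indicator hS (fun j => (a j : ℝ))
  simp only [arrayOf_val, ha] at hw ha'
  have hval := h (fun j => if (j : ℕ) ∈ S then 1 else 0)
    ⟨fun j => by by_cases hj : (j : ℕ) ∈ S <;> simp [hj], by rw [hw]; exact hle⟩
  rw [ha'] at hval
  have : b ≤ ∑ j ∈ S, a j := by exact_mod_cast hval
  omega

/-! ### The running time -/

/-- A polynomial with natural coefficients is monotone on the nonnegative reals. -/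
theorem Polynomial.natCast_eval_le_aeval (P : Polynomial ℕ) {m : ℕ} {y : ℝ} (h : (m : ℝ) ≤ y) :
    ((P.eval m : ℕ) : ℝ) ≤ Polynomial.aeval y P := by
  induction P using Polynomial.induction_on' with
  | add P Q hP hQ => simpa using add_le_add hP hQ
  | monomial k c =>
    simp only [Polynomial.eval_monomial, Polynomial.aeval_monomial]
    push_cast
    have : (m : ℝ) ^ k ≤ y ^ k := pow_le_pow_left₀ (by positivity) h k
    exact mul_le_mul_of_nonneg_left this (by positivity)

/-- A running time that is polynomial in `n` and in `1 / ε` rounded up is polynomial in `n` and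
`1 / ε`. -/
theorem exists_time_bound (p : ℕ) (P : Polynomial ℕ) : ∃ T : MvPolynomial (Fin 2) ℝ,
    ∀ (n : ℕ) (ε : ℝ), 0 < ε → ((30 * ⌈1 / ε⌉₊ + 60 + P.eval
      (n + ⌈1 / ε⌉₊ + n * (n * (⌈1 / ε⌉₊ * (p * p))) + (p + 1)) : ℕ) : ℝ) ≤
        MvPolynomial.eval ![(n : ℝ), 1 / ε] T := by
  obtain ⟨K, hK⟩ : ∃ K : MvPolynomial (Fin 2) ℝ, K = .X 1 + 1 := ⟨_, rfl⟩
  obtain ⟨N, hN⟩ : ∃ N : MvPolynomial (Fin 2) ℝ, N = .X 0 := ⟨_, rfl⟩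
  refine ⟨30 * K + 60 + Polynomial.aeval
    (N + K + N * (N * (K * ((p : MvPolynomial (Fin 2) ℝ) * p))) + (p + 1)) P, fun n ε hε => ?_⟩
  have hK' : (⌈1 / ε⌉₊ : ℝ) ≤ MvPolynomial.eval ![(n : ℝ), 1 / ε] K := by
    rw [hK]
    simpa using (Nat.ceil_lt_add_one (by positivity : 0 ≤ 1 / ε)).le
  have hN' : MvPolynomial.eval ![(n : ℝ), 1 / ε] N = n := by simp [hN]
  have hP : MvPolynomial.eval ![(n : ℝ), 1 / ε] (Polynomial.aeval
      (N + K + N * (N * (K * ((p : MvPolynomial (Fin 2) ℝ) * p))) + (p + 1)) P) =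
      Polynomial.aeval (MvPolynomial.eval ![(n : ℝ), 1 / ε]
        (N + K + N * (N * (K * ((p : MvPolynomial (Fin 2) ℝ) * p))) + (p + 1))) P := by
    rw [Polynomial.aeval_def, Polynomial.hom_eval₂, Polynomial.aeval_def]
    congr 1
    exact Subsingleton.elim _ _
  rw [map_add, hP]
  push_cast
  refine add_le_add ?_ (Polynomial.natCast_eval_le_aeval P ?_)
  · simp only [map_add, map_mul, map_ofNat]
    linarith
  · simp only [map_add, map_mul, map_natCast, map_one, hN']
    push_cast
    gcongr

theorem theorem4 (p : ℕ) (hp : 1 ≤ p) :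
    ∃ (P : RAM.Program) (T : MvPolynomial (Fin 2) ℝ),
      ∀ (n : ℕ) (w : Fin n → ℕ) (w₀ : ℕ) (ε : ℝ) (x : Fin n → ℝ),
        0 < ε → ε < 1 → (∀ j, x j ∈ Set.Icc (0 : ℝ) 1) →
          ∃ (s : RAM.Store) (t : ℕ),
            RAM.Exec P (sepInput w w₀ ε x) s t ∧
            (t : ℝ) ≤ MvPolynomial.eval ![(n : ℝ), 1 / ε] T ∧
            CorrectAnswer p w w₀ ε x s := by

  obtain ⟨T, hT⟩ := exists_time_bound p ((RAM.Cmd.levelsCmd p).time + (RAM.mainCmd p).time)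
  refine ⟨RAM.sepProgram p, T, fun n w w₀ ε x hε _ hx => ?_⟩
  obtain ⟨s, t, hready, hexec, ht⟩ := RAM.sepProgram_exec (p := p) w w₀ x hε
  refine ⟨_, t, hexec, le_trans (by exact_mod_cast ht) (hT n ε hε), ?_⟩
  have hx0 : ∀ j, 0 ≤ arrayOf x j := fun j => by
    simp only [arrayOf]; split; exacts [(hx _).1, le_rfl]
  have hx1 : ∀ j, arrayOf x j ≤ 1 := fun j => by
    simp only [arrayOf]; split; exacts [(hx _).2, zero_le_one]
  have hw : ∀ j, 0 ≤ arrayOf (fun j => (w j : ℝ)) j := fun j => by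
    simp only [arrayOf]; split; exacts [Nat.cast_nonneg _, le_rfl]
  have hsum : ∀ a : ℕ → ℕ, ∑ j ∈ Finset.range n, (a j : ℝ) * arrayOf x j =
      ∑ j : Fin n, (a j : ℝ) * x j := fun a => by
    rw [Finset.sum_range]; simp
  rcases hready.mainCmd_run hp hε hx0 hx1 hw (by simp [arrayOf]) with
    ⟨h1, hc, hb, hb1, hval, hviol⟩ | ⟨h0, h⟩
  · refine .inl ⟨h1, ⟨fun j => hc j j.2, hb⟩, isValidIneq_of_knapsack_lt hval, ?_⟩
    rwa [hsum] at hviol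
  · refine .inr ⟨h0, fun α α₀ ⟨hα, hα₀⟩ hvalid => ?_⟩
    rcases Nat.eq_zero_or_pos α₀ with rfl | hpos
    · have : 0 ≤ ∑ j, (α j : ℝ) * x j :=
        Finset.sum_nonneg fun j _ => mul_nonneg (Nat.cast_nonneg _) (hx j).1
      push_cast
      linarith
    · obtain ⟨a, ha⟩ : ∃ a : ℕ → ℕ, a = fun i => if h : i < n then α ⟨i, h⟩ else 0 := ⟨_, rfl⟩
      have ha' : ∀ j : Fin n, a j = α j := fun j => by simp [ha]
      have := h a α₀ (fun j => by
          rw [ha]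
          dsimp only
          split
          exacts [hα _, Nat.zero_le _]) hpos hα₀
        fun S hS hSb => hvalid.sum_lt hpos ha' hS hSb
      rw [hsum] at this
      simpa only [ha'] using this
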